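/- **Proposition 3.4.** Let $d=2n+1\ge 3$ be odd and let $G$ be $\mathrm{SO}^0(d,1)$ or its universal covering $\mathrm{Spin}(d,1)$, acting on real hyperbolic space $\mathbb{H}^d=G/K$ of curvature $-1$ with base point $eK$. Let $\mathfrak{g}$ be the Lie algebra of $G$, let $G=KAN$ be the standard Iwasawa decomposition, $M$ the centralizer of $A$ in $K$, $\alpha$ the positive root of $(\mathfrak{g},\mathfrak{a})$, $H_{\mathbb{R}}\in\mathfrak{a}$ the vector with $\alpha(H_{\mathbb{R}})=1$, $A^+=\{\exp(tH_{\mathbb{R}}):t>0\}$, $\overline{\mathfrak{n}}$ the sum of the negative root spaces, and $|\rho|=\frac12\dim(\mathfrak{g}_\alpha)$. Let $\Gamma\subset G$ be a discrete torsion-free subgroup with $\Gamma\backslash G$ compact. For $\gamma\in\Gamma$, $\gamma\ne e$, put $l(\gamma)=\inf_{x\in\mathbb{H}^d}d(x,\gamma x)$ and let $m_\gamma\in M$, $a_\gamma\in A^+$ be such that $\gamma$ is conjugate in $G$ to $m_\gamma a_\gamma$. A conjugacy class $[\gamma]\neq e$ in $\Gamma$ is prime if $\gamma$ is not of the form $\gamma_0^k$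 with $\gamma_0\in\Gamma$, $k>1$. Let $\chi\colon\Gamma\to\mathrm{GL}(V_\chi)$ be a finite-dimensional complex representation and let $\sigma$ be a unitary irreducible representation of $M$. Then there exists a constant $c>0$ such that the infinite product $$Z(s;\sigma,\chi)=\prod_{\substack{[\gamma]\neq e\\ [\gamma]\text{ prime}}}\ \prod_{k=0}^{\infty}\det\Big(\mathrm{Id}-\big(\chi(\gamma)\otimes\sigma(m_\gamma)\otimes S^k(\mathrm{Ad}(m_\gamma a_\gamma)|_{\overline{\mathfrak{n}}})\big)e^{-(s+|\rho|)l(\gamma)}\Big)$$ converges absolutely and uniformly on compact subsets of the half-plane $\mathrm{Re}(s)>c$. That is, writing $F_{[\gamma],k}(s)$ for the factors, on every compact subset of this half-plane the series $\sum_{[\gamma],k}|F_{[\gamma],k}(s)-1|$ converges uniformly, and the product over all pairs $([\gamma],k)$, each inner product over $k$, and the outer product over $[\gamma]$ of the inner products converge uniformly, the first and the last of these to $Z(s;\sigma,\chi)$. -/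

import Mathlib

open scoped TensorProduct

noncomputable section

namespace HypZeta

/-! ### Minkowski space and hyperbolic space of odd dimension `d = 2n+1` -/

/-- Minkowski space `ℝ^{d+1}`, `d = 2n+1`, with time coordinate `0`. -/
abbrev Mink (n : ℕ) : Type := Fin (2 * n + 2) → ℝ

/-- The signs `(-1, 1, …, 1)`. -/
def sgn (n : ℕ) (i : Fin (2 * n + 2)) : ℝ := if i = 0 then -1 else 1

/-- The Lorentz form `-x₀y₀ + x₁y₁ + … + x_d y_d`. -/
def lorentz {n : ℕ} (x y : Mink n) : ℝ := ∑ i, sgn n i * (x i * y i)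

/-- The Lorentz form as a quadratic form. -/
def lorentzQ (n : ℕ) : QuadraticForm ℝ (Mink n) := QuadraticMap.weightedSumSquares ℝ (sgn n)

/-- The hyperboloid model of hyperbolic space `ℍ^d`. -/
def hyperboloid (n : ℕ) : Set (Mink n) := {x | lorentz x x = -1 ∧ 0 < x 0}

/-- The geodesic distance on the hyperboloid for the metric of constant curvature `-1`. -/
def hypDist {n : ℕ} (x y : Mink n) : ℝ := Real.arcosh (-lorentz x y)

/-- The base point `e₀` of `ℍ^d`. -/
def basePt (n : ℕ) : Mink n := Pi.single 0 1

/-- The vector `H_ℝ ∈ 𝔞 ⊂ 𝔰𝔬(d,1)`, given by `e₀ ↦ e₁`, `e₁ ↦ e₀` and `e_i ↦ 0` for `i ≥ 2`. -/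
def genH (n : ℕ) : Module.End ℝ (Mink n) where
  toFun x := Pi.single 0 (x 1) + Pi.single 1 (x 0)
  map_add' x y := by
    simp only [Pi.add_apply, Pi.single_add]; abel
  map_smul' c x := by
    simp only [Pi.smul_apply, Pi.single_smul, smul_add, RingHom.id_apply]

/-- `exp (t H_ℝ)`, written out with `H_ℝ³ = H_ℝ`: the boost of rapidity `t` in the `(e₀,e₁)`-plane. -/
def boostMap (n : ℕ) (t : ℝ) : Module.End ℝ (Mink n) :=
  1 + Real.sinh t • genH n + (Real.cosh t - 1) • (genH n * genH n)

/-- The Lie algebra `𝔰𝔬(d,1)`. -/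
def lieG (n : ℕ) : Submodule ℝ (Module.End ℝ (Mink n)) where
  carrier := {X | ∀ x y, lorentz (X x) y + lorentz x (X y) = 0}
  add_mem' {X Y} hX hY x y := by
    have h1 := hX x y
    have h2 := hY x y
    simp only [lorentz, LinearMap.add_apply, Pi.add_apply, mul_add, add_mul,
      Finset.sum_add_distrib] at *
    linarith
  zero_mem' x y := by simp [lorentz]
  smul_mem' c X hX x y := by
    have h1 := hX x y
    simp only [lorentz, LinearMap.smul_apply, Pi.smul_apply, smul_eq_mul] at *
    have := congrArg (c * ·) h1
    simp only [mul_add, Finset.mul_sum, mul_zero] at this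
    rw [← this]
    congr 1 <;> refine Finset.sum_congr rfl fun i _ => by ring

/-- The restricted root space `{X ∈ 𝔤 | [H_ℝ, X] = c X}`. The positive root `α`, with
`α(H_ℝ) = 1`, corresponds to `c = 1` and the negative one to `c = -1`. -/
def rootSpace (n : ℕ) (c : ℝ) : Submodule ℝ (Module.End ℝ (Mink n)) where
  carrier := {X | X ∈ lieG n ∧ genH n * X - X * genH n = c • X}
  add_mem' {X Y} hX hY := ⟨add_mem hX.1 hY.1, by
    rw [smul_add, ← hX.2, ← hY.2, mul_add, add_mul]; abel⟩
  zero_mem' := ⟨zero_mem _, by simp⟩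
  smul_mem' a X hX := ⟨Submodule.smul_mem _ a hX.1, by
    rw [smul_comm c a X, ← hX.2, smul_sub, mul_smul_comm, smul_mul_assoc]⟩

/-- `𝔫̄`, the sum of the negative restricted root spaces. -/
abbrev nbar (n : ℕ) : Submodule ℝ (Module.End ℝ (Mink n)) := rootSpace n (-1)

/-- `|ρ|`, that is `ρ(H_ℝ)` for `ρ = ½ dim(𝔤_α) α`. -/
def rhoNorm (n : ℕ) : ℝ := (Module.finrank ℝ (rootSpace n 1) : ℝ) / 2

/-! ### Lorentz groups and their subgroups -/

/-- A topological group `G` acting linearly on Minkowski space by Lorentz transformations, together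
with the curve `t ↦ exp (t H_ℝ)` in `G` whose image is the subgroup `A`. It serves only to treat
the two groups `SO⁰(d,1)` and `Spin(d,1)`, constructed below, simultaneously. -/
structure LorentzModel (n : ℕ) where
  G : Type
  [group : Group G]
  [top : TopologicalSpace G]
  vec : Representation ℝ G (Mink n)
  expH : ℝ → G
  lorentz_vec : ∀ g x, lorentz (vec g x) (vec g x) = lorentz x x
  vec_expH : ∀ t, vec (expH t) = boostMap n t

attribute [instance] LorentzModel.group LorentzModel.top

namespace LorentzModel

variable {n : ℕ} (𝒢 : LorentzModel n)

/-- `K`, the stabilizer of the base point of `ℍ^d = G/K`. -/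
def K : Subgroup 𝒢.G where
  carrier := {g | 𝒢.vec g (basePt n) = basePt n}
  mul_mem' {a b} ha hb := by
    simp only [Set.mem_ofPred_eq] at *
    rw [map_mul, Module.End.mul_apply, hb, ha]
  one_mem' := by simp
  inv_mem' {a} ha := by
    simp only [Set.mem_ofPred_eq] at *
    conv_lhs => rw [← ha]
    rw [← Module.End.mul_apply, ← map_mul, inv_mul_cancel, map_one, Module.End.one_apply]

/-- `M`, the centralizer of `A = {exp (t H_ℝ)}` in `K`. -/
def M : Subgroup 𝒢.G := 𝒢.K ⊓ Subgroup.centralizer (Set.range 𝒢.expH)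

/-- `l(g) = inf {d(x, g x) : x ∈ ℍ^d}`; for `1 ≠ γ ∈ Γ` this is the length of the closed geodesic
attached to the conjugacy class of `γ`. -/
def length (g : 𝒢.G) : ℝ := sInf ((fun x => hypDist x (𝒢.vec g x)) '' hyperboloid n)

/-- The adjoint action of `G` on endomorphisms of Minkowski space, hence on `𝔤`. -/
def Ad (g : 𝒢.G) : Module.End ℝ (Mink n) →ₗ[ℝ] Module.End ℝ (Mink n) where
  toFun X := 𝒢.vec g * X * 𝒢.vec g⁻¹
  map_add' X Y := by rw [mul_add, add_mul]
  map_smul' c X := by rw [mul_smul_comm, smul_mul_assoc, RingHom.id_apply]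

end LorentzModel

theorem lorentz_add_left {n : ℕ} (x y z : Mink n) :
    lorentz (x + y) z = lorentz x z + lorentz y z := by
  simp only [lorentz, Pi.add_apply, ← Finset.sum_add_distrib]
  exact Finset.sum_congr rfl fun i _ => by ring

theorem lorentz_comm {n : ℕ} (x y : Mink n) : lorentz x y = lorentz y x :=
  Finset.sum_congr rfl fun i _ => by ring

theorem lorentzQ_apply {n : ℕ} (x : Mink n) : lorentzQ n x = lorentz x x := by
  simp [lorentzQ, lorentz, QuadraticMap.weightedSumSquares_apply]

theorem genH_cube (n : ℕ) : genH n * genH n * genH n = genH n := by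
  refine LinearMap.ext fun x => ?_
  simp [genH, Module.End.mul_apply]

theorem genH_mul_boostMap (n : ℕ) (t : ℝ) : genH n * boostMap n t = boostMap n t * genH n := by
  simp only [boostMap, mul_add, add_mul, mul_one, one_mul, mul_smul_comm, smul_mul_assoc, mul_assoc]

theorem boostMap_add (n : ℕ) (s t : ℝ) : boostMap n (s + t) = boostMap n s * boostMap n t := by
  have h3 : genH n * (genH n * genH n) = genH n := by rw [← mul_assoc]; exact genH_cube n
  simp only [boostMap, mul_add, add_mul, mul_one, one_mul, mul_smul_comm, smul_mul_assoc,
    mul_assoc, h3, Real.sinh_add, Real.cosh_add]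
  module

namespace LorentzModel

variable {n : ℕ} (𝒢 : LorentzModel n)

theorem lorentz_vec_vec (g : 𝒢.G) (x y : Mink n) :
    lorentz (𝒢.vec g x) (𝒢.vec g y) = lorentz x y := by
  have h := 𝒢.lorentz_vec g (x + y)
  have hx := 𝒢.lorentz_vec g x
  have hy := 𝒢.lorentz_vec g y
  rw [map_add, lorentz_add_left, lorentz_comm _ (_ + _), lorentz_comm _ (_ + _), lorentz_add_left,
    lorentz_add_left, lorentz_add_left, lorentz_comm _ (x + y), lorentz_comm _ (x + y),
    lorentz_add_left, lorentz_add_left, lorentz_comm (𝒢.vec g y) (𝒢.vec g x),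
    lorentz_comm y x] at h
  linarith

theorem vec_mul_inv (g : 𝒢.G) : 𝒢.vec g * 𝒢.vec g⁻¹ = 1 := by
  rw [← map_mul, mul_inv_cancel, map_one]

theorem vec_inv_mul (g : 𝒢.G) : 𝒢.vec g⁻¹ * 𝒢.vec g = 1 := by
  rw [← map_mul, inv_mul_cancel, map_one]

theorem genH_comm_of_mem_M {m : 𝒢.G} (hm : m ∈ 𝒢.M) :
    genH n * 𝒢.vec m = 𝒢.vec m * genH n := by
  have h : ∀ t, boostMap n t * 𝒢.vec m = 𝒢.vec m * boostMap n t := fun t => by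
    have := Subgroup.mem_centralizer_iff.1 hm.2 (𝒢.expH t) ⟨t, rfl⟩
    rw [← 𝒢.vec_expH, ← map_mul, ← map_mul, this]
  have hs : Real.sinh 1 ≠ 0 := (Real.sinh_pos_iff.2 one_pos).ne'
  have key : genH n = (2 * Real.sinh 1)⁻¹ • (boostMap n 1 - boostMap n (-1)) := by
    have : boostMap n 1 - boostMap n (-1) = (2 * Real.sinh 1) • genH n := by
      simp only [boostMap, Real.sinh_neg, Real.cosh_neg]; module
    rw [this, smul_smul, inv_mul_cancel₀ (by positivity), one_smul]
  rw [key, smul_mul_assoc, mul_smul_comm, sub_mul, mul_sub, h, h]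

/-- An element `g` of `MA` preserves the root spaces under `Ad`. -/
theorem Ad_mem_rootSpace {m : 𝒢.G} (hm : m ∈ 𝒢.M) (t c : ℝ) {X : Module.End ℝ (Mink n)}
    (hX : X ∈ rootSpace n c) : 𝒢.Ad (m * 𝒢.expH t) X ∈ rootSpace n c := by
  set g := m * 𝒢.expH t with hg
  have hcomm : genH n * 𝒢.vec g = 𝒢.vec g * genH n := by
    rw [hg, map_mul, 𝒢.vec_expH, ← mul_assoc, 𝒢.genH_comm_of_mem_M hm, mul_assoc,
      genH_mul_boostMap, mul_assoc]
  have hcomm' : genH n * 𝒢.vec g⁻¹ = 𝒢.vec g⁻¹ * genH n := by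
    calc genH n * 𝒢.vec g⁻¹ = 𝒢.vec g⁻¹ * 𝒢.vec g * genH n * 𝒢.vec g⁻¹ := by
          rw [𝒢.vec_inv_mul, one_mul]
      _ = 𝒢.vec g⁻¹ * (genH n * 𝒢.vec g) * 𝒢.vec g⁻¹ := by rw [hcomm, ← mul_assoc]
      _ = 𝒢.vec g⁻¹ * genH n * (𝒢.vec g * 𝒢.vec g⁻¹) := by simp only [mul_assoc]
      _ = _ := by rw [𝒢.vec_mul_inv, mul_one]
  refine ⟨fun x y => ?_, ?_⟩
  · have h := hX.1 (𝒢.vec g⁻¹ x) (𝒢.vec g⁻¹ y)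
    rw [← 𝒢.lorentz_vec_vec g (X _), ← 𝒢.lorentz_vec_vec g _ (X _)] at h
    simp only [← Module.End.mul_apply] at h
    rw [𝒢.vec_mul_inv] at h
    simpa [Ad, Module.End.mul_apply, mul_assoc] using h
  · change genH n * (𝒢.vec g * X * 𝒢.vec g⁻¹) - 𝒢.vec g * X * 𝒢.vec g⁻¹ * genH n =
      c • (𝒢.vec g * X * 𝒢.vec g⁻¹)
    rw [mul_assoc _ _ (genH n), ← hcomm', ← smul_mul_assoc, ← mul_smul_comm c, ← hX.2]
    simp only [mul_sub, sub_mul, ← mul_assoc, hcomm]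

/-- `Ad (m a)|_𝔫̄` for `m ∈ M` and `a = exp (t H_ℝ)`. -/
def adNbar (m : 𝒢.M) (t : ℝ) : nbar n →ₗ[ℝ] nbar n :=
  (𝒢.Ad (m * 𝒢.expH t)).restrict fun _ hX => 𝒢.Ad_mem_rootSpace m.2 t (-1) hX

end LorentzModel

/-! ### The group `SO⁰(d,1)` -/

/-- `SO⁰(d,1)`: the real matrices of determinant one that preserve the Lorentz form and the upper
sheet `ℍ^d` of the hyperboloid. -/
def SO0 (n : ℕ) : Subgroup (Matrix.SpecialLinearGroup (Fin (2 * n + 2)) ℝ) where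
  carrier := {g | (∀ x y : Mink n, lorentz (g.1.mulVec x) (g.1.mulVec y) = lorentz x y) ∧
    ∀ x : Mink n, g.1.mulVec x ∈ hyperboloid n ↔ x ∈ hyperboloid n}
  mul_mem' {a b} ha hb := by
    refine ⟨fun x y => ?_, fun x => ?_⟩
    · rw [Matrix.SpecialLinearGroup.coe_mul, ← Matrix.mulVec_mulVec, ← Matrix.mulVec_mulVec,
        ha.1, hb.1]
    · rw [Matrix.SpecialLinearGroup.coe_mul, ← Matrix.mulVec_mulVec, ha.2, hb.2]
  one_mem' := by simp
  inv_mem' {a} ha := by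
    have h : ∀ x : Mink n, a.1.mulVec (a⁻¹.1.mulVec x) = x := fun x => by
      rw [Matrix.mulVec_mulVec, ← Matrix.SpecialLinearGroup.coe_mul, mul_inv_cancel,
        Matrix.SpecialLinearGroup.coe_one, Matrix.one_mulVec]
    refine ⟨fun x y => ?_, fun x => ?_⟩
    · rw [← ha.1, h, h]
    · rw [← ha.2, h]

theorem genH_apply {n : ℕ} (x : Mink n) : genH n x = Pi.single 0 (x 1) + Pi.single 1 (x 0) := rfl

theorem boostMap_apply_zero {n : ℕ} (t : ℝ) (x : Mink n) :
    boostMap n t x 0 = Real.cosh t * x 0 + Real.sinh t * x 1 := by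
  simp [boostMap, genH_apply, Module.End.mul_apply]; ring

theorem boostMap_apply_one {n : ℕ} (t : ℝ) (x : Mink n) :
    boostMap n t x 1 = Real.sinh t * x 0 + Real.cosh t * x 1 := by
  simp [boostMap, genH_apply, Module.End.mul_apply]; ring

theorem boostMap_apply_of_ne {n : ℕ} (t : ℝ) (x : Mink n) {i : Fin (2 * n + 2)} (h0 : i ≠ 0)
    (h1 : i ≠ 1) : boostMap n t x i = x i := by
  simp [boostMap, genH_apply, Module.End.mul_apply, h0, h1]

theorem lorentz_eq {n : ℕ} (x y : Mink n) :
    lorentz x y = -(x 0 * y 0) + x 1 * y 1 + ∑ i : Fin (2 * n), x i.succ.succ * y i.succ.succ := by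
  rw [lorentz, Fin.sum_univ_succ, Fin.sum_univ_succ]
  simp [sgn, Fin.succ_ne_zero]
  ring

theorem lorentz_boostMap {n : ℕ} (t : ℝ) (x y : Mink n) :
    lorentz (boostMap n t x) (boostMap n t y) = lorentz x y := by
  have h (z : Mink n) (i : Fin (2 * n)) : boostMap n t z i.succ.succ = z i.succ.succ :=
    boostMap_apply_of_ne t z (Fin.succ_ne_zero _) (by simp [Fin.ext_iff])
  rw [lorentz_eq, lorentz_eq]
  simp only [h, boostMap_apply_zero, boostMap_apply_one]
  linear_combination (x 1 * y 1 - x 0 * y 0) * Real.cosh_sq_sub_sinh_sq t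

theorem boostMap_zero (n : ℕ) : boostMap n 0 = 1 := by simp [boostMap]

theorem boostMap_mem {n : ℕ} (t : ℝ) {x : Mink n} (hx : x ∈ hyperboloid n) :
    boostMap n t x ∈ hyperboloid n := by
  refine ⟨by rw [lorentz_boostMap, hx.1], ?_⟩
  have h1 := hx.1
  have h2 := hx.2
  rw [lorentz_eq] at h1
  have h3 : 0 ≤ ∑ i : Fin (2 * n), x i.succ.succ * x i.succ.succ :=
    Finset.sum_nonneg fun i _ => mul_self_nonneg _
  have h4 : |x 1| < x 0 := abs_lt_of_sq_lt_sq (by nlinarith) h2.le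
  have h5 : |Real.sinh t| < Real.cosh t :=
    abs_lt_of_sq_lt_sq (by rw [Real.cosh_sq]; linarith) (Real.cosh_pos t).le
  rw [boostMap_apply_zero]
  have h6 : |Real.sinh t * x 1| < Real.cosh t * x 0 := by
    rw [abs_mul]; exact mul_lt_mul'' h5 h4 (abs_nonneg _) (abs_nonneg _)
  linarith [neg_abs_le (Real.sinh t * x 1)]

/-- The reflection `e₁ ↦ -e₁`, which inverts the boosts. -/
def flip (n : ℕ) : Mink n ≃ₗ[ℝ] Mink n :=
  LinearEquiv.piCongrRight fun i => if i = 1 then LinearEquiv.neg ℝ else LinearEquiv.refl ℝ ℝ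

theorem flip_apply {n : ℕ} (x : Mink n) (i : Fin (2 * n + 2)) :
    flip n x i = if i = 1 then -x i else x i := by
  by_cases h : i = 1 <;> simp [flip, h]

theorem det_boostMap (n : ℕ) (t : ℝ) : LinearMap.det (boostMap n t) = 1 := by
  have hflip : ∀ s, LinearMap.det (boostMap n (-s)) = LinearMap.det (boostMap n s) := fun s => by
    rw [← LinearMap.det_conj (boostMap n s) (flip n)]
    congr 1
    refine LinearMap.ext fun x => funext fun i => ?_
    obtain ⟨y, rfl⟩ := (flip n).surjective x
    simp only [LinearMap.comp_apply, LinearEquiv.coe_coe, LinearEquiv.symm_apply_apply]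
    rw [flip_apply]
    by_cases h1 : i = 1
    · subst h1
      simp [boostMap_apply_one, flip_apply]; ring
    · by_cases h0 : i = 0
      · subst h0
        simp [boostMap_apply_zero, flip_apply]
      · simp [boostMap_apply_of_ne, flip_apply, h0, h1]
  have h1 : LinearMap.det (boostMap n (t / 2)) * LinearMap.det (boostMap n (t / 2)) = 1 := by
    nth_rewrite 2 [← hflip]
    rw [← map_mul, ← boostMap_add, add_neg_cancel, boostMap_zero, map_one]
  rw [← h1, ← map_mul, ← boostMap_add, add_halves]

/-- The group `G = SO⁰(d,1)` with its standard action on Minkowski space. -/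
def soModel (n : ℕ) : LorentzModel n where
  G := SO0 n
  vec :=
    { toFun := fun g => Matrix.toLin' g.1.1
      map_one' := by simp; rfl
      map_mul' := fun a b => by simp [Matrix.toLin'_mul]; rfl }
  expH t := ⟨⟨LinearMap.toMatrix' (boostMap n t), by
      rw [LinearMap.det_toMatrix', det_boostMap]⟩, by
    have h : ∀ x, (LinearMap.toMatrix' (boostMap n t)).mulVec x = boostMap n t x := fun x => by
      rw [← Matrix.toLin'_apply, Matrix.toLin'_toMatrix']
    refine ⟨fun x y => ?_, fun x => ?_⟩
    · simp only [h, lorentz_boostMap]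
    · simp only [h]
      refine ⟨fun hx => ?_, boostMap_mem t⟩
      have := boostMap_mem (-t) hx
      rwa [← Module.End.mul_apply, ← boostMap_add, neg_add_cancel, boostMap_zero] at this⟩
  lorentz_vec g x := by
    simpa using g.2.1 x x
  vec_expH t := by simp

/-! ### The group `Spin(d,1)` -/

open CliffordAlgebra in
theorem cliffordι_injective (n : ℕ) : Function.Injective (ι (lorentzQ n)) := fun x y h => by
  have := congrArg (equivExterior (lorentzQ n)) h
  simpa using this

open CliffordAlgebra in
theorem spin_conj_mem {n : ℕ} (g : spinGroup (lorentzQ n)) (x : Mink n) :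
    (g : CliffordAlgebra (lorentzQ n)) * ι (lorentzQ n) x * star (g : CliffordAlgebra (lorentzQ n)) ∈
      LinearMap.range (ι (lorentzQ n)) :=
  spinGroup.conjAct_smul_ι_mem_range_ι (x := spinGroup.toUnits g) g.2 x

open CliffordAlgebra in
/-- The vector representation of `Spin(d,1)`: `x ↦ g x g⁻¹` in the Clifford algebra, where
`g⁻¹ = star g`. This is the double covering `Spin(d,1) → SO⁰(d,1)`. -/
def spinVecMap {n : ℕ} (g : spinGroup (lorentzQ n)) : Mink n →ₗ[ℝ] Mink n :=
  (LinearEquiv.ofInjective (ι (lorentzQ n)) (cliffordι_injective n)).symm.toLinearMap ∘ₗ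
    LinearMap.codRestrict (LinearMap.range (ι (lorentzQ n)))
      (LinearMap.mulRight ℝ (star (g : CliffordAlgebra (lorentzQ n))) ∘ₗ
        LinearMap.mulLeft ℝ (g : CliffordAlgebra (lorentzQ n)) ∘ₗ ι (lorentzQ n))
      (spin_conj_mem g)

open CliffordAlgebra in
theorem ι_spinVecMap {n : ℕ} (g : spinGroup (lorentzQ n)) (x : Mink n) :
    ι (lorentzQ n) (spinVecMap g x) = (g : CliffordAlgebra (lorentzQ n)) * ι (lorentzQ n) x *
      star (g : CliffordAlgebra (lorentzQ n)) := by
  have h := LinearEquiv.apply_symm_apply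
    (LinearEquiv.ofInjective (ι (lorentzQ n)) (cliffordι_injective n))
    ⟨_, spin_conj_mem g x⟩
  exact congrArg Subtype.val h

/-- `Spin(d,1)` acting on Minkowski space by the vector representation. -/
def spinVec (n : ℕ) : Representation ℝ (spinGroup (lorentzQ n)) (Mink n) where
  toFun := spinVecMap
  map_one' := LinearMap.ext fun x => cliffordι_injective n <| by
    rw [ι_spinVecMap]; simp
  map_mul' a b := LinearMap.ext fun x => cliffordι_injective n <| by
    rw [Module.End.mul_apply, ι_spinVecMap, ι_spinVecMap, ι_spinVecMap]
    simp [mul_assoc]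

open CliffordAlgebra in
theorem ι_mul_ι_of_orthogonal {n : ℕ} {x y : Mink n} (h : lorentz x y = 0) :
    ι (lorentzQ n) x * ι (lorentzQ n) y = -(ι (lorentzQ n) y * ι (lorentzQ n) x) := by
  refine ι_mul_ι_comm_of_isOrtho ?_
  rw [QuadraticMap.isOrtho_def, lorentzQ_apply, lorentzQ_apply, lorentzQ_apply, lorentz_add_left,
    lorentz_comm _ (x + y), lorentz_comm _ (x + y), lorentz_add_left, lorentz_add_left,
    lorentz_comm y x, h]
  ring

/-- The basis vector `e₀` in the Clifford algebra. -/
def cl0 (n : ℕ) : CliffordAlgebra (lorentzQ n) := CliffordAlgebra.ι _ (Pi.single 0 1)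
/-- The basis vector `e₁` in the Clifford algebra. -/
def cl1 (n : ℕ) : CliffordAlgebra (lorentzQ n) := CliffordAlgebra.ι _ (Pi.single 1 1)

theorem cl0_sq (n : ℕ) : cl0 n * cl0 n = -1 := by
  rw [cl0, CliffordAlgebra.ι_sq_scalar, lorentzQ_apply, lorentz_eq]
  simp [Fin.ext_iff]

theorem cl1_sq (n : ℕ) : cl1 n * cl1 n = 1 := by
  rw [cl1, CliffordAlgebra.ι_sq_scalar, lorentzQ_apply, lorentz_eq]
  simp [Fin.ext_iff]

theorem cl1_mul_cl0 (n : ℕ) : cl1 n * cl0 n = -(cl0 n * cl1 n) := by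
  refine ι_mul_ι_of_orthogonal ?_
  rw [lorentz_eq]
  simp [Fin.ext_iff]

/-- `exp (t e₀e₁ / 2) = cosh (t/2) + sinh (t/2) e₀e₁` in the Clifford algebra. -/
def spinBoost (n : ℕ) (t : ℝ) : CliffordAlgebra (lorentzQ n) :=
  algebraMap ℝ _ (Real.cosh (t / 2)) + Real.sinh (t / 2) • (cl0 n * cl1 n)

open CliffordAlgebra in
theorem star_spinBoost (n : ℕ) (t : ℝ) :
    star (spinBoost n t) =
      algebraMap ℝ _ (Real.cosh (t / 2)) - Real.sinh (t / 2) • (cl0 n * cl1 n) := by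
  have h0 : star (cl0 n) = -cl0 n := star_ι _
  have h1 : star (cl1 n) = -cl1 n := star_ι _
  rw [spinBoost, star_add, CliffordAlgebra.star_smul, star_mul, h0, h1, star_algebraMap,
    neg_mul_neg, cl1_mul_cl0, smul_neg, sub_eq_add_neg]

theorem cl01_sq (n : ℕ) : cl0 n * cl1 n * (cl0 n * cl1 n) = 1 := by
  rw [mul_assoc, ← mul_assoc (cl1 n), cl1_mul_cl0, neg_mul, mul_neg, mul_assoc, cl1_sq, mul_one,
    cl0_sq, neg_neg]

open CliffordAlgebra in
theorem spinBoost_mem (n : ℕ) (t : ℝ) : spinBoost n t ∈ spinGroup (lorentzQ n) := by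
  have hc := Real.cosh_sq_sub_sinh_sq (t / 2)
  -- `spinBoost` is the product of `e₀` and the unit timelike vector `-cosh e₀ + sinh e₁`
  set v : Mink n := Pi.single 0 (-Real.cosh (t / 2)) + Pi.single 1 (Real.sinh (t / 2)) with hv
  have hιv : ι (lorentzQ n) v = -Real.cosh (t / 2) • cl0 n + Real.sinh (t / 2) • cl1 n := by
    rw [cl0, cl1, ← map_smul, ← map_smul, ← map_add, hv, ← Pi.single_smul, ← Pi.single_smul]
    simp
  have hprod : spinBoost n t = cl0 n * ι (lorentzQ n) v := by
    rw [hιv, mul_add, mul_smul_comm, mul_smul_comm, cl0_sq, spinBoost, Algebra.algebraMap_eq_smul_one]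
    simp
  have hQv : lorentzQ n v = -1 := by
    rw [lorentzQ_apply, lorentz_eq]
    simp [hv, Fin.ext_iff]
    linarith
  have hQ0 : lorentzQ n (Pi.single 0 1) = -1 := by
    rw [lorentzQ_apply, lorentz_eq]
    simp [Fin.ext_iff]
  obtain ⟨u0, hu0⟩ := isUnit_ι_of_isUnit (lorentzQ n) (m := Pi.single 0 1)
    (by rw [hQ0]; exact isUnit_one.neg)
  obtain ⟨u1, hu1⟩ := isUnit_ι_of_isUnit (lorentzQ n) (m := v)
    (by rw [hQv]; exact isUnit_one.neg)
  refine ⟨⟨⟨u0 * u1, mul_mem (Subgroup.subset_closure ⟨_, hu0.symm⟩)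
    (Subgroup.subset_closure ⟨_, hu1.symm⟩), ?_⟩, ?_⟩, ?_⟩
  · rw [hprod]; simp [hu0, hu1, cl0]
  · have key : ∀ a b : ℝ, (algebraMap ℝ _ a - b • (cl0 n * cl1 n)) *
        (algebraMap ℝ _ a + b • (cl0 n * cl1 n)) = algebraMap ℝ _ (a ^ 2 - b ^ 2) := fun a b => by
      simp only [Algebra.algebraMap_eq_smul_one, sub_mul, mul_add, smul_mul_smul_comm, one_mul,
        mul_one, cl01_sq]
      module
    have key' : ∀ a b : ℝ, (algebraMap ℝ _ a + b • (cl0 n * cl1 n)) *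
        (algebraMap ℝ _ a - b • (cl0 n * cl1 n)) = algebraMap ℝ _ (a ^ 2 - b ^ 2) := fun a b => by
      simp only [Algebra.algebraMap_eq_smul_one, add_mul, mul_sub, smul_mul_smul_comm, one_mul,
        mul_one, cl01_sq]
      module
    exact ⟨by rw [star_spinBoost, spinBoost, key, hc, map_one],
      by rw [star_spinBoost, spinBoost, key', hc, map_one]⟩
  · rw [hprod]
    exact ι_mul_ι_mem_evenOdd_zero _ _ _

open CliffordAlgebra in
theorem spinVec_spinBoost (n : ℕ) (t : ℝ) :
    spinVec n ⟨spinBoost n t, spinBoost_mem n t⟩ = boostMap n t := by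
  refine LinearMap.ext fun x => cliffordι_injective n ?_
  change ι _ (spinVecMap _ x) = _
  rw [ι_spinVecMap]
  change spinBoost n t * ι _ x * star (spinBoost n t) = _
  rw [star_spinBoost, spinBoost]
  set y : Mink n := x - Pi.single 0 (x 0) - Pi.single 1 (x 1) with hy
  have hy0 : y 0 = 0 := by simp [hy]
  have hy1 : y 1 = 0 := by simp [hy]
  have hx : ι (lorentzQ n) x = x 0 • cl0 n + x 1 • cl1 n + ι (lorentzQ n) y := by
    rw [cl0, cl1, ← map_smul, ← map_smul, ← map_add, ← map_add, hy, ← Pi.single_smul,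
      ← Pi.single_smul]
    congr 1; simp
  have hb : ι (lorentzQ n) (boostMap n t x) = (Real.cosh t * x 0 + Real.sinh t * x 1) • cl0 n +
      (Real.sinh t * x 0 + Real.cosh t * x 1) • cl1 n + ι (lorentzQ n) y := by
    rw [cl0, cl1, ← map_smul, ← map_smul, ← map_add, ← map_add, hy, ← Pi.single_smul,
      ← Pi.single_smul]
    congr 1
    funext i
    by_cases h1 : i = 1
    · subst h1; simp [boostMap_apply_one]
    · by_cases h0 : i = 0
      · subst h0; simp [boostMap_apply_zero]
      · simp [boostMap_apply_of_ne, h0, h1]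
  have h0y : ι (lorentzQ n) y * cl0 n = -(cl0 n * ι (lorentzQ n) y) :=
    ι_mul_ι_of_orthogonal (by rw [lorentz_eq]; simp [hy0, Fin.ext_iff])
  have h1y : ι (lorentzQ n) y * cl1 n = -(cl1 n * ι (lorentzQ n) y) :=
    ι_mul_ι_of_orthogonal (by rw [lorentz_eq]; simp [hy1, Fin.ext_iff])
  set a := Real.cosh (t / 2) with ha
  set b := Real.sinh (t / 2) with hb'
  have hab : a ^ 2 - b ^ 2 = 1 := Real.cosh_sq_sub_sinh_sq _
  have hct : Real.cosh t = a ^ 2 + b ^ 2 := by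
    rw [ha, hb', ← Real.cosh_two_mul]; ring_nf
  have hst : Real.sinh t = 2 * b * a := by
    rw [ha, hb', ← Real.sinh_two_mul]; ring_nf
  set E := cl0 n * cl1 n with hE
  have hEE : E * E = 1 := cl01_sq n
  have hE0 : E * cl0 n = cl1 n := by
    rw [hE, mul_assoc, cl1_mul_cl0, mul_neg, ← mul_assoc, cl0_sq]; simp
  have hE0' : cl0 n * E = -cl1 n := by rw [hE, ← mul_assoc, cl0_sq]; simp
  have hE1 : E * cl1 n = cl0 n := by rw [hE, mul_assoc, cl1_sq, mul_one]
  have hE1' : cl1 n * E = -cl0 n := by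
    rw [hE, ← mul_assoc, cl1_mul_cl0, neg_mul, mul_assoc, cl1_sq, mul_one]
  have hEy : ι (lorentzQ n) y * E = E * ι (lorentzQ n) y := by
    rw [hE, ← mul_assoc, h0y, neg_mul, mul_assoc, h1y, mul_neg, neg_neg, mul_assoc]
  have hEyE : E * ι (lorentzQ n) y * E = ι (lorentzQ n) y := by
    rw [mul_assoc, hEy, ← mul_assoc, hEE, one_mul]
  rw [hx, hb, hct, hst]
  simp only [Algebra.algebraMap_eq_smul_one, add_mul, mul_add, mul_sub, smul_mul_assoc,
    mul_smul_comm, one_mul, mul_one, hE0, hE0', hE1, hE1', hEy, hEyE]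
  have hy' : ι (lorentzQ n) y = (a ^ 2 - b ^ 2) • ι (lorentzQ n) y := by rw [hab, one_smul]
  conv_rhs => rw [hy']
  module

/-- The group `G = Spin(d,1)`, inside the Clifford algebra of the Lorentz form, with the topology
induced by the canonical one of this finite-dimensional real vector space. -/
def spinModel (n : ℕ) : LorentzModel n where
  G := spinGroup (lorentzQ n)
  top := (moduleTopology ℝ (CliffordAlgebra (lorentzQ n))).induced Subtype.val
  vec := spinVec n
  expH t := ⟨spinBoost n t, spinBoost_mem n t⟩
  lorentz_vec g x := by
    rw [← lorentzQ_apply, ← lorentzQ_apply]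
    apply (algebraMap ℝ (CliffordAlgebra (lorentzQ n))).injective
    rw [← CliffordAlgebra.ι_sq_scalar, ← CliffordAlgebra.ι_sq_scalar]
    change CliffordAlgebra.ι _ (spinVecMap g x) * CliffordAlgebra.ι _ (spinVecMap g x) = _
    rw [ι_spinVecMap]
    calc g.1 * CliffordAlgebra.ι _ x * star g.1 * (g.1 * CliffordAlgebra.ι _ x * star g.1)
        = g.1 * (CliffordAlgebra.ι _ x * (star g.1 * g.1) * CliffordAlgebra.ι _ x) * star g.1 := by
          simp only [mul_assoc]
      _ = _ := by
          rw [spinGroup.star_mul_self_of_mem g.2, mul_one, CliffordAlgebra.ι_sq_scalar,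
            ← Algebra.commutes, mul_assoc, spinGroup.mul_star_self_of_mem g.2, mul_one]
  vec_expH t := spinVec_spinBoost n t

/-! ### Symmetric powers -/

/-- The `k`-th symmetric power `S^k(U)`: the part of degree `k` of the symmetric algebra, spanned by
the products of `k` vectors. -/
def symPow (R U : Type*) [CommRing R] [AddCommGroup U] [Module R U] (k : ℕ) :
    Submodule R (SymmetricAlgebra R U) :=
  LinearMap.range (SymmetricAlgebra.ι R U) ^ k

/-- The algebra endomorphism of the symmetric algebra induced by a linear map. -/
def symAlgMap {R U : Type*} [CommRing R] [AddCommGroup U] [Module R U] (f : U →ₗ[R] U) :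
    SymmetricAlgebra R U →ₐ[R] SymmetricAlgebra R U :=
  SymmetricAlgebra.lift (SymmetricAlgebra.ι R U ∘ₗ f)

theorem symAlgMap_mem {R U : Type*} [CommRing R] [AddCommGroup U] [Module R U] (f : U →ₗ[R] U)
    (k : ℕ) (x : SymmetricAlgebra R U) (hx : x ∈ symPow R U k) :
    symAlgMap f x ∈ symPow R U k := by
  have h : (symPow R U k).map (symAlgMap f).toLinearMap ≤ symPow R U k := by
    rw [symPow, Submodule.map_pow]
    refine pow_le_pow_left' ?_ k
    rintro _ ⟨_, ⟨u, rfl⟩, rfl⟩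
    exact ⟨f u, by simp [symAlgMap]⟩
  exact h ⟨x, hx, rfl⟩

/-- `S^k(f)`, given by `u₁ ⋯ u_k ↦ f(u₁) ⋯ f(u_k)`. -/
def symPowMap {R U : Type*} [CommRing R] [AddCommGroup U] [Module R U] (f : U →ₗ[R] U) (k : ℕ) :
    symPow R U k →ₗ[R] symPow R U k :=
  (symAlgMap f).toLinearMap.restrict (symAlgMap_mem f k)

/-! ### The twisted Selberg zeta function -/

/-- The nontrivial prime conjugacy classes of a group `Γ`: those with no element of the form `γ₀^k`
with `k > 1`. -/
def PrimeClass (Γ : Type*) [Group Γ] : Type _ :=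
  {C : ConjClasses Γ // C ≠ ConjClasses.mk 1 ∧
    ∀ γ : Γ, ConjClasses.mk γ = C → ¬∃ (k : ℕ) (γ₀ : Γ), 1 < k ∧ γ = γ₀ ^ k}

/-- A representative of a prime conjugacy class. -/
def PrimeClass.rep {Γ : Type*} [Group Γ] (C : PrimeClass Γ) : Γ := Quotient.out C.1

/-- `σ` is a unitary irreducible representation of the topological group `M`. -/
structure IsUnitaryIrrep {M W : Type*} [Group M] [TopologicalSpace M] [NormedAddCommGroup W]
    [InnerProductSpace ℂ W] (σ : Representation ℂ M W) : Prop where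
  unitary : ∀ m v w, inner ℂ (σ m v) (σ m w) = inner ℂ v w
  continuous : ∀ w, Continuous fun m => σ m w
  irreducible : σ.IsIrreducible

namespace LorentzModel

variable {n : ℕ} (𝒢 : LorentzModel n)

/-- `g` is conjugate in `G` to `m a` with `m ∈ M` and `a = exp (t H_ℝ) ∈ A⁺`, where
`p = (m, t)` and `t > 0`. -/
def IsMA (g : 𝒢.G) (p : 𝒢.M × ℝ) : Prop :=
  0 < p.2 ∧ ∃ h : 𝒢.G, h⁻¹ * g * h = p.1 * 𝒢.expH p.2

open Classical in
/-- A choice of `(m_γ, t_γ)` with `γ` conjugate to `m_γ a_γ`, `a_γ = exp (t_γ H_ℝ) ∈ A⁺`. It exists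
for all hyperbolic elements, in particular for all nontrivial elements of a torsion-free cocompact
discrete subgroup, so that the default value is never used for those. -/
def maPart (g : 𝒢.G) : 𝒢.M × ℝ :=
  if h : ∃ p, 𝒢.IsMA g p then h.choose else (1, 𝒢.length g)

variable {Γ : Subgroup 𝒢.G} {V W : Type*} [AddCommGroup V] [Module ℂ V] [AddCommGroup W]
  [Module ℂ W]

/-- The operator `χ(γ) ⊗ σ(m_γ) ⊗ S^k(Ad(m_γ a_γ)|_𝔫̄)`. -/
def twistedOp (χ : Representation ℂ Γ V) (σ : Representation ℂ 𝒢.M W) (γ : Γ) (k : ℕ) :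
    Module.End ℂ ((V ⊗[ℂ] W) ⊗[ℂ] symPow ℂ (ℂ ⊗[ℝ] nbar n) k) :=
  TensorProduct.map (TensorProduct.map (χ γ) (σ (𝒢.maPart γ).1))
    (symPowMap ((𝒢.adNbar (𝒢.maPart γ).1 (𝒢.maPart γ).2).baseChange ℂ) k)

/-- The local factor
`det (Id - (χ(γ) ⊗ σ(m_γ) ⊗ S^k(Ad(m_γ a_γ)|_𝔫̄)) e^{-(s+|ρ|) l(γ)})`. -/
def selbergFactor (χ : Representation ℂ Γ V) (σ : Representation ℂ 𝒢.M W) (γ : Γ) (k : ℕ)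
    (s : ℂ) : ℂ :=
  LinearMap.det (1 - Complex.exp (-(s + rhoNorm n) * 𝒢.length γ) • 𝒢.twistedOp χ σ γ k)

/-- The twisted Selberg zeta function
`Z(s;σ,χ) = ∏_{[γ] ≠ e prime} ∏_{k ≥ 0} det (Id - (χ(γ) ⊗ σ(m_γ) ⊗ S^k(Ad(m_γ a_γ)|_𝔫̄)) e^{-(s+|ρ|) l(γ)})`. -/
def selbergZeta (χ : Representation ℂ Γ V) (σ : Representation ℂ 𝒢.M W) (s : ℂ) : ℂ :=
  ∏' C : PrimeClass Γ, ∏' k : ℕ, 𝒢.selbergFactor χ σ C.rep k s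

end LorentzModel

end HypZeta

end

/-! Each factor is `det (1 - A)` with `A` small, and the proof bounds the sum of `|det (1 - A) - 1|`
over all pairs `([γ], k)`. The number of classes and the size of `χ(γ)`, which need not be unitary,
may both grow exponentially in `l(γ)`; one construction controls both.

By cocompactness (`exists_radius`) a fixed ball meets every `Γ`-orbit in hyperbolic space, and by
discreteness only finitely many elements `S` of `Γ` move some point of the ball to within distance
one of the ball. Cut a geodesic from `y` to `γ y`, of almost minimal length, into steps of length at
most one and carry each division point back into the ball: this writes a conjugate of `γ` as a word
in `S` of length at most `l(γ) + 2` (`exists_finite_words`). A word determines its class, so at most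
`|S| ^ N` classes have a chosen word of length `N`; and `χ` of a word of length `N` has size at most
`K * B ^ N` (`exists_growthLE_word`).

The size of an operator is measured by `GrowthLE`, the growth of the coefficients of its powers.
This needs no norm, passes to tensor products, quotients and complexifications, is insensitive to
conjugation in `Γ`, and bounds the eigenvalues, which is all that a determinant sees. The unitary
`σ` contributes `1`. On `𝔫̄` the boost acts by `e^{-t}` and `M` acts boundedly, so `S^k` contributes
`e^{-kt} ≤ e^{-k l(γ)}`, while its dimension is polynomial in `k`. Torsion-freeness makes the action
free, hence `l(γ) ≥ l₀ > 0` (`exists_pos_le_length`), and the decay in `k` is uniformly geometric.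

For `Re s > c` the deviation of a factor from `1` is therefore `O(q ^ N * (k + 1) ^ P * e^{-k l₀})`
with `q = B e^{-c}`. For `c` large, `|S| q < 1`; the bound is summable, and `uniform_double_product`
gives every form of convergence.

The two groups enter only through `IsGeometric`. The substantial point is that a bound on the
displacement of `e₀` leaves finitely many elements of a discrete subgroup: for `SO⁰(d,1)` it bounds
matrix entries, for `Spin(d,1)` it bounds Clifford coefficients by means of an invariant inner
product. -/

noncomputable section

namespace HypZeta

/-! ### Geometry of the hyperboloid -/

section Hyperboloid

variable {n : ℕ}

theorem lorentz_smul_left (c : ℝ) (x y : Mink n) : lorentz (c • x) y = c * lorentz x y := by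
  simp only [lorentz, Pi.smul_apply, smul_eq_mul, Finset.mul_sum]
  exact Finset.sum_congr rfl fun i _ => by ring

theorem lorentz_smul_right (c : ℝ) (x y : Mink n) : lorentz x (c • y) = c * lorentz x y := by
  rw [lorentz_comm, lorentz_smul_left, lorentz_comm]

theorem lorentz_add_right (x y z : Mink n) : lorentz x (y + z) = lorentz x y + lorentz x z := by
  rw [lorentz_comm, lorentz_add_left, lorentz_comm y, lorentz_comm z]

theorem lorentz_neg_left (x y : Mink n) : lorentz (-x) y = -lorentz x y := by
  simpa using lorentz_smul_left (-1) x y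

theorem lorentz_neg_right (x y : Mink n) : lorentz x (-y) = -lorentz x y := by
  simpa using lorentz_smul_right (-1) x y

theorem lorentz_sub_left (x y z : Mink n) : lorentz (x - y) z = lorentz x z - lorentz y z := by
  rw [sub_eq_add_neg, lorentz_add_left, lorentz_neg_left, sub_eq_add_neg]

theorem lorentz_sub_right (x y z : Mink n) : lorentz x (y - z) = lorentz x y - lorentz x z := by
  rw [sub_eq_add_neg, lorentz_add_right, lorentz_neg_right, sub_eq_add_neg]

theorem lorentz_eq_sum_succ (x y : Mink n) :
    lorentz x y = -(x 0 * y 0) + ∑ i : Fin (2 * n + 1), x i.succ * y i.succ := by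
  rw [lorentz, Fin.sum_univ_succ]
  simp [sgn, Fin.succ_ne_zero]

theorem lorentz_self (x : Mink n) :
    lorentz x x = -(x 0) ^ 2 + ∑ i : Fin (2 * n + 1), x i.succ ^ 2 := by
  rw [lorentz_eq_sum_succ]; simp only [pow_two]

theorem continuous_lorentz {X : Type*} [TopologicalSpace X] {f g : X → Mink n} (hf : Continuous f)
    (hg : Continuous g) : Continuous fun x => lorentz (f x) (g x) := by
  unfold lorentz; fun_prop

theorem sq_sum_succ_le (x y : Mink n) :
    (∑ i : Fin (2 * n + 1), x i.succ * y i.succ) ^ 2 ≤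
      (∑ i : Fin (2 * n + 1), x i.succ ^ 2) * ∑ i : Fin (2 * n + 1), y i.succ ^ 2 :=
  Finset.sum_mul_sq_le_sq_mul_sq _ _ _

theorem sum_succ_sq_of_mem {x : Mink n} (hx : x ∈ hyperboloid n) :
    ∑ i : Fin (2 * n + 1), x i.succ ^ 2 = x 0 ^ 2 - 1 := by
  have := hx.1
  rw [lorentz_self] at this; linarith

theorem one_le_zero_coord {x : Mink n} (hx : x ∈ hyperboloid n) : 1 ≤ x 0 := by
  have h := sum_succ_sq_of_mem hx
  have h' : 0 ≤ ∑ i : Fin (2 * n + 1), x i.succ ^ 2 := Finset.sum_nonneg fun i _ => sq_nonneg _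
  nlinarith [hx.2]

theorem abs_coord_le {x : Mink n} (hx : x ∈ hyperboloid n) (i : Fin (2 * n + 2)) :
    |x i| ≤ x 0 := by
  refine Fin.cases ?_ (fun j => ?_) i
  · rw [abs_of_pos hx.2]
  · have h := sum_succ_sq_of_mem hx
    have h' : x j.succ ^ 2 ≤ ∑ i : Fin (2 * n + 1), x i.succ ^ 2 :=
      Finset.single_le_sum (f := fun i : Fin (2 * n + 1) => x i.succ ^ 2)
        (fun i _ => sq_nonneg _) (Finset.mem_univ j)
    exact abs_le_of_sq_le_sq (by linarith) hx.2.le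

/-- Reversed Cauchy–Schwarz inequality, obtained from the ordinary one on the space coordinates. It
puts `-lorentz x y` in the range where `cosh` inverts `arcosh`. -/
theorem one_le_neg_lorentz {x y : Mink n} (hx : x ∈ hyperboloid n) (hy : y ∈ hyperboloid n) :
    1 ≤ -lorentz x y := by
  have h := sq_sum_succ_le x y
  rw [sum_succ_sq_of_mem hx, sum_succ_sq_of_mem hy] at h
  have h1 := one_le_zero_coord hx
  have h2 := one_le_zero_coord hy
  rw [lorentz_eq_sum_succ]
  have h3 : ∑ i : Fin (2 * n + 1), x i.succ * y i.succ ≤ x 0 * y 0 - 1 :=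
    le_of_abs_le (abs_le_of_sq_le_sq (by nlinarith [sq_nonneg (x 0 - y 0)]) (by nlinarith))
  linarith

/-- A weak triangle inequality through `x` for the distance from `e₀` to `y`, in the form `cosh (a +
b) ≤ 2 cosh a cosh b`. -/
theorem zero_coord_le_mul_neg_lorentz {x y : Mink n} (hx : x ∈ hyperboloid n)
    (hy : y ∈ hyperboloid n) : y 0 ≤ 2 * x 0 * -lorentz x y := by
  have h := sq_sum_succ_le x y
  rw [sum_succ_sq_of_mem hx, sum_succ_sq_of_mem hy] at h
  have h1 := one_le_zero_coord hx
  have h2 := one_le_zero_coord hy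
  rw [lorentz_eq_sum_succ]
  set s := ∑ i : Fin (2 * n + 1), x i.succ * y i.succ
  -- Squaring reduces this to Cauchy–Schwarz, since `(2 x₀² - 1)² = 4 x₀² (x₀² - 1) + 1`.
  have h3 : 2 * x 0 * s ≤ (2 * x 0 ^ 2 - 1) * y 0 := by
    refine le_of_abs_le (abs_le_of_sq_le_sq ?_ (by nlinarith))
    have : 4 * x 0 ^ 2 * s ^ 2 ≤ 4 * x 0 ^ 2 * ((x 0 ^ 2 - 1) * (y 0 ^ 2 - 1)) := by gcongr
    have h5 : 0 ≤ x 0 ^ 2 * (x 0 ^ 2 - 1) := mul_nonneg (sq_nonneg _) (by nlinarith)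
    nlinarith [sq_nonneg (y 0)]
  nlinarith

/-- The difference `y - x` is a null vector orthogonal to the timelike vector `x`, hence zero. -/
theorem eq_of_neg_lorentz_eq_one {x y : Mink n} (hx : x ∈ hyperboloid n) (hy : y ∈ hyperboloid n)
    (h : -lorentz x y = 1) : x = y := by
  set z := y - x with hz
  have hzx : lorentz x z = 0 := by rw [hz, lorentz_sub_right, hx.1]; linarith
  have hzz : lorentz z z = 0 := by
    rw [hz, lorentz_sub_left, lorentz_sub_right, lorentz_sub_right, hx.1, hy.1, lorentz_comm y x]
    linarith
  have hc := sq_sum_succ_le x z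
  rw [sum_succ_sq_of_mem hx] at hc
  rw [lorentz_eq_sum_succ] at hzx
  rw [lorentz_self] at hzz
  have e1 : ∑ i : Fin (2 * n + 1), x i.succ * z i.succ = x 0 * z 0 := by linarith
  have e2 : ∑ i : Fin (2 * n + 1), z i.succ ^ 2 = z 0 ^ 2 := by linarith
  rw [e1, e2] at hc
  have h0 : z 0 ^ 2 = 0 := le_antisymm (by nlinarith) (sq_nonneg _)
  rw [h0] at e2
  have h1 := (Finset.sum_eq_zero_iff_of_nonneg fun i _ => sq_nonneg _).1 e2
  have : z = 0 := funext fun i =>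
    Fin.cases (pow_eq_zero_iff two_ne_zero |>.1 h0)
      (fun j => pow_eq_zero_iff two_ne_zero |>.1 (h1 j (Finset.mem_univ j))) i
  exact (sub_eq_zero.1 this).symm

/-- On the lower sheet, `-z` would lie on the upper one and its pairing with `x` would have the
wrong sign. -/
theorem mem_hyperboloid_of_lorentz_neg {x z : Mink n} (hx : x ∈ hyperboloid n)
    (hz : lorentz z z = -1) (hxz : lorentz x z < 0) : z ∈ hyperboloid n := by
  refine ⟨hz, lt_of_not_ge fun h0 => ?_⟩
  have hz0 : z 0 ≠ 0 := fun h0 => by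
    rw [lorentz_self, h0] at hz
    have : 0 ≤ ∑ i : Fin (2 * n + 1), z i.succ ^ 2 := Finset.sum_nonneg fun i _ => sq_nonneg _
    linarith
  have hneg : -z ∈ hyperboloid n := by
    refine ⟨by rw [lorentz_neg_left, lorentz_neg_right, neg_neg, hz], ?_⟩
    have : z 0 < 0 := lt_of_le_of_ne h0 hz0
    simpa using this
  have := one_le_neg_lorentz hx hneg
  rw [lorentz_neg_right] at this
  linarith

theorem basePt_mem (n : ℕ) : basePt n ∈ hyperboloid n := by
  refine ⟨?_, by simp [basePt]⟩
  rw [lorentz_eq_sum_succ]; simp [basePt]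

theorem lorentz_basePt (x : Mink n) : lorentz (basePt n) x = -x 0 := by
  rw [lorentz_eq_sum_succ]; simp [basePt]

theorem cosh_hypDist {x y : Mink n} (hx : x ∈ hyperboloid n) (hy : y ∈ hyperboloid n) :
    Real.cosh (hypDist x y) = -lorentz x y :=
  Real.cosh_arcosh (one_le_neg_lorentz hx hy)

theorem hypDist_nonneg {x y : Mink n} (hx : x ∈ hyperboloid n) (hy : y ∈ hyperboloid n) :
    0 ≤ hypDist x y := Real.arcosh_nonneg (one_le_neg_lorentz hx hy)

/-- Two points of the hyperboloid are joined by a chain of points with steps of length at most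
one, the number of steps being any natural number not less than the distance. -/
theorem exists_chain {x y : Mink n} (hx : x ∈ hyperboloid n) (hy : y ∈ hyperboloid n) {N : ℕ}
    (hN : hypDist x y ≤ N) :
    ∃ z : ℕ → Mink n, (∀ j, z j ∈ hyperboloid n) ∧ z 0 = x ∧ z N = y ∧
      ∀ j, -lorentz (z j) (z (j + 1)) ≤ Real.cosh 1 := by
  set t := hypDist x y with ht
  have hcosh : lorentz x y = -Real.cosh t := by rw [ht, cosh_hypDist hx hy, neg_neg]
  -- Distance zero is separate: `N` may be `0`, and the initial direction below is normalised by
  -- `sinh t`.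
  rcases (hypDist_nonneg hx hy).eq_or_lt' with h0 | hpos
  · have hxy : x = y := eq_of_neg_lorentz_eq_one hx hy (by
      rw [hcosh, neg_neg, ht, h0, Real.cosh_zero])
    refine ⟨fun _ => x, fun _ => hx, rfl, hxy, fun _ => ?_⟩
    rw [hx.1, neg_neg]; exact Real.one_le_cosh 1
  · rw [← ht] at hpos
    have hs : Real.sinh t ≠ 0 := (Real.sinh_pos_iff.2 hpos).ne'
    have hN0 : (0 : ℝ) < N := hpos.trans_le hN
    -- The unit tangent vector at `x` pointing to `y`; `p` below is the unit speed geodesic, sampled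
    -- at multiples of `t / N`.
    set u : Mink n := (Real.sinh t)⁻¹ • (y - Real.cosh t • x) with hu
    have hxu : lorentz x u = 0 := by
      rw [hu, lorentz_smul_right, lorentz_sub_right, lorentz_smul_right, hx.1, hcosh]; ring
    have huu : lorentz u u = 1 := by
      rw [hu, lorentz_smul_right, lorentz_smul_left, lorentz_sub_left, lorentz_sub_right,
        lorentz_sub_right, lorentz_smul_left, lorentz_smul_left, lorentz_smul_right,
        lorentz_smul_right, hx.1, hy.1, lorentz_comm y x, hcosh]
      field_simp
      linarith [Real.cosh_sq t]
    set p : ℝ → Mink n := fun s => Real.cosh s • x + Real.sinh s • u with hp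
    have hpp : ∀ s s', lorentz (p s) (p s') = -Real.cosh (s - s') := fun s s' => by
      simp only [hp, lorentz_add_left, lorentz_add_right, lorentz_smul_left, lorentz_smul_right,
        hx.1, huu, hxu, lorentz_comm u x, Real.cosh_sub]
      ring
    have hp0 : p 0 = x := by simp [hp]
    refine ⟨fun j => p (j * (t / N)), fun j => ?_, by simpa using hp0, ?_, fun j => ?_⟩
    · refine mem_hyperboloid_of_lorentz_neg hx (by rw [hpp]; simp) ?_
      conv_lhs => rw [← hp0]
      rw [hpp]; exact neg_lt_zero.2 (Real.cosh_pos _)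
    · have : (N : ℝ) * (t / N) = t := by field_simp
      simp only [this, hp, hu, smul_smul, mul_inv_cancel₀ hs]
      simp
    · rw [hpp, neg_neg, Real.cosh_le_cosh, abs_one]
      have : (j : ℝ) * (t / N) - ((j + 1 : ℕ) : ℝ) * (t / N) = -(t / N) := by push_cast; ring
      rw [this, abs_neg, abs_of_nonneg (by positivity)]
      exact (div_le_one hN0).2 hN

end Hyperboloid

/-! ### Discrete groups of Lorentz transformations -/

/-- The properties of the action of `G` on hyperbolic space that are common to `SO⁰(d,1)` and
`Spin(d,1)`: it is continuous, transitive, and discrete subgroups act properly. -/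
structure LorentzModel.IsGeometric {n : ℕ} (𝒢 : LorentzModel n) : Prop where
  vec_mem : ∀ g, ∀ x ∈ hyperboloid n, 𝒢.vec g x ∈ hyperboloid n
  transitive : ∀ x ∈ hyperboloid n, ∃ g, 𝒢.vec g (basePt n) = x
  continuous_vec : Continuous fun g => 𝒢.vec g (basePt n) 0
  continuous_mul_left : ∀ a : 𝒢.G, Continuous fun g => a * g
  finite_of_discrete : ∀ Γ : Subgroup 𝒢.G, DiscreteTopology Γ → ∀ R : ℝ,
    {γ : Γ | 𝒢.vec γ (basePt n) 0 ≤ R}.Finite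

/-- A set of points in a finite product of lines that is bounded and uniformly separated is
finite. -/
theorem finite_of_separated {ι κ : Type*} [Fintype ι] (f : κ → ι → ℝ) {R ε : ℝ} (hε : 0 < ε)
    (hR : ∀ k, ‖f k‖ ≤ R) (hsep : ∀ k l, k ≠ l → ε ≤ dist (f k) (f l)) : Finite κ := by
  have hb : TotallyBounded (Set.range f) :=
    (isCompact_closedBall (0 : ι → ℝ) R).totallyBounded.subset (by
      rintro _ ⟨k, rfl⟩; simpa using hR k)
  obtain ⟨t, ht, hcov⟩ := Metric.totallyBounded_iff.1 hb (ε / 2) (by positivity)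
  have : ∀ k, ∃ c : t, f k ∈ Metric.ball (c : ι → ℝ) (ε / 2) := fun k => by
    obtain ⟨c, hc, hk⟩ := Set.mem_iUnion₂.1 (hcov ⟨k, rfl⟩)
    exact ⟨⟨c, hc⟩, hk⟩
  choose c hc using this
  have : Finite t := ht
  refine Finite.of_injective c fun k l hkl => by_contra fun hne => ?_
  have h1 := hc k
  have h2 := hc l
  rw [hkl] at h1
  have h3 := dist_triangle_right (f k) (f l) (c l : ι → ℝ)
  have := hsep k l hne
  rw [Metric.mem_ball] at h1 h2
  linarith

/-- In a group with a topology induced from a matrix algebra, a discrete subgroup contains only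
finitely many elements that are, together with their inverses, in a given bounded set. -/
theorem finite_of_inducing {G ι : Type*} [Group G] [TopologicalSpace G] [Fintype ι] [DecidableEq ι]
    (φ : G →* Matrix ι ι ℝ) (hφ : Topology.IsInducing φ) (Γ : Subgroup G) (hΓ : DiscreteTopology Γ)
    (R : ℝ) : {γ : Γ | (∀ i j, |φ γ i j| ≤ R) ∧ ∀ i j, |φ (γ⁻¹ : Γ) i j| ≤ R}.Finite := by
  let e : Matrix ι ι ℝ → (ι × ι → ℝ) := fun A p => A p.1 p.2
  -- Discreteness isolates the identity; the bound on inverses then spreads this isolation to a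
  -- uniform separation.
  obtain ⟨U, hU, hU1⟩ : ∃ U : Set (Matrix ι ι ℝ), IsOpen U ∧ ∀ γ : Γ, φ γ ∈ U ↔ γ = 1 := by
    have h1 : IsOpen ({1} : Set Γ) := isOpen_discrete _
    obtain ⟨V, hV, hV1⟩ := (hφ.comp Topology.IsInducing.subtypeVal).isOpen_iff.1 h1
    refine ⟨V, hV, fun γ => ?_⟩
    have := Set.ext_iff.1 hV1 γ
    simpa using this
  obtain ⟨ε, hε, hball⟩ : ∃ ε > 0, ∀ A : Matrix ι ι ℝ, (∀ i j, |A i j - (1 : Matrix ι ι ℝ) i j| < ε) →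
      A ∈ U := by
    have hU' : IsOpen {f : ι → ι → ℝ | (Matrix.of f) ∈ U} := hU
    have h1 : (fun i j => (1 : Matrix ι ι ℝ) i j) ∈ {f : ι → ι → ℝ | (Matrix.of f) ∈ U} := by
      have := (hU1 1).2 rfl
      rw [OneMemClass.coe_one, map_one] at this
      exact this
    obtain ⟨ε, hε, hb⟩ := Metric.isOpen_iff.1 hU' _ h1
    refine ⟨ε, hε, fun A hA => ?_⟩
    have : (fun i j => A i j) ∈ Metric.ball (fun i j => (1 : Matrix ι ι ℝ) i j) ε := by
      rw [Metric.mem_ball, dist_pi_lt_iff hε]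
      intro i
      rw [dist_pi_lt_iff hε]
      intro j
      rw [Real.dist_eq]; exact hA i j
    exact hb this
  set B := {γ : Γ | (∀ i j, |φ γ i j| ≤ R) ∧ ∀ i j, |φ (γ⁻¹ : Γ) i j| ≤ R}
  set R' := max R 0
  set M : ℝ := Fintype.card ι * R' + 1 with hM
  have hMpos : 0 < M := by positivity
  refine finite_of_separated (fun γ : B => e (φ γ.1)) (R := R') (ε := ε / M) (by positivity)
    (fun γ => ?_) fun γ δ hne => ?_
  · rw [pi_norm_le_iff_of_nonneg (le_max_right _ _)]
    exact fun p => (γ.2.1 p.1 p.2).trans (le_max_left _ _)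
  · by_contra hlt
    rw [not_le, dist_pi_lt_iff (by positivity)] at hlt
    refine hne (Subtype.ext ?_)
    -- Uses `φ(γ δ⁻¹) - 1 = (φ γ - φ δ) φ(δ⁻¹)`. The summand `1` in `M` makes the final inequality
    -- strict.
    have key : γ.1 * δ.1⁻¹ = 1 := by
      rw [← hU1]
      refine hball _ fun i j => ?_
      have hd : φ (δ.1 : G) * φ ((δ.1⁻¹ : Γ) : G) = 1 := by
        rw [← map_mul]; simp
      rw [← hd, Subgroup.coe_mul, map_mul, ← Matrix.sub_apply, ← sub_mul, Matrix.mul_apply]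
      calc |∑ k, (φ (γ.1 : G) - φ (δ.1 : G)) i k * φ ((δ.1⁻¹ : Γ) : G) k j|
          ≤ ∑ k, |(φ (γ.1 : G) - φ (δ.1 : G)) i k * φ ((δ.1⁻¹ : Γ) : G) k j| :=
            Finset.abs_sum_le_sum_abs _ _
        _ ≤ ∑ _k : ι, ε / M * R' := by
            refine Finset.sum_le_sum fun k _ => ?_
            rw [abs_mul]
            refine mul_le_mul ?_ ((δ.2.2 k j).trans (le_max_left _ _)) (abs_nonneg _)
              (by positivity)
            have := hlt (i, k)
            rw [Real.dist_eq] at this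
            exact this.le
        _ = ε * (Fintype.card ι * R' / M) := by
            rw [Finset.sum_const, Finset.card_univ, nsmul_eq_mul]; ring
        _ < ε * 1 := by
            gcongr
            rw [div_lt_one hMpos, hM]; linarith
        _ = ε := mul_one _
    exact mul_inv_eq_one.1 key

/-! ### Displacement of `e₀` and the size of matrix entries -/

namespace LorentzModel

variable {n : ℕ} (𝒢 : LorentzModel n)

theorem lorentz_vec_right (g : 𝒢.G) (x y : Mink n) :
    lorentz x (𝒢.vec g y) = lorentz (𝒢.vec g⁻¹ x) y := by
  rw [← 𝒢.lorentz_vec_vec g (𝒢.vec g⁻¹ x) y, ← Module.End.mul_apply, 𝒢.vec_mul_inv,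
    Module.End.one_apply]

theorem vec_inv_basePt_zero (g : 𝒢.G) :
    𝒢.vec g⁻¹ (basePt n) 0 = 𝒢.vec g (basePt n) 0 := by
  have h := 𝒢.lorentz_vec_right g (basePt n) (basePt n)
  rw [lorentz_basePt, lorentz_comm, lorentz_basePt] at h
  linarith

/-- The right side is the squared Euclidean norm of `g x`: the Lorentz form plus twice the square of
the time coordinate, which is `-⟨g⁻¹ e₀, x⟩`. -/
theorem vec_apply_sq_le (g : 𝒢.G) (x : Mink n) (i : Fin (2 * n + 2)) :
    (𝒢.vec g x i) ^ 2 ≤ lorentz x x + 2 * lorentz (𝒢.vec g⁻¹ (basePt n)) x ^ 2 := by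
  have h1 := 𝒢.lorentz_vec g x
  rw [lorentz_self (𝒢.vec g x)] at h1
  have h2 := 𝒢.lorentz_vec_right g (basePt n) x
  rw [lorentz_basePt] at h2
  rw [← h1, ← h2]
  have h3 : ∀ j : Fin (2 * n + 1), 𝒢.vec g x j.succ ^ 2 ≤ ∑ i : Fin (2 * n + 1),
      𝒢.vec g x i.succ ^ 2 := fun j =>
    Finset.single_le_sum (f := fun i : Fin (2 * n + 1) => 𝒢.vec g x i.succ ^ 2)
      (fun i _ => sq_nonneg _) (Finset.mem_univ j)
  refine Fin.cases ?_ (fun j => ?_) i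
  · nlinarith [sq_nonneg (𝒢.vec g x 0), h3 0, sq_nonneg (𝒢.vec g x (Fin.succ 0))]
  · nlinarith [sq_nonneg (𝒢.vec g x 0), h3 j]

end LorentzModel

theorem lorentz_single_right {n : ℕ} (x : Mink n) (j : Fin (2 * n + 2)) :
    lorentz x (Pi.single j 1) = sgn n j * x j := by
  rw [lorentz, Finset.sum_eq_single j (by intro i _ h; simp [h]) (by simp)]
  simp

theorem sgn_sq (n : ℕ) (j : Fin (2 * n + 2)) : sgn n j ^ 2 = 1 := by
  unfold sgn; split_ifs <;> norm_num

theorem sgn_le_one (n : ℕ) (j : Fin (2 * n + 2)) : sgn n j ≤ 1 := by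
  unfold sgn; split_ifs <;> norm_num

theorem LorentzModel.abs_vec_single_le {n : ℕ} (𝒢 : LorentzModel n)
    (hmem : ∀ g, ∀ x ∈ hyperboloid n, 𝒢.vec g x ∈ hyperboloid n) {g : 𝒢.G} {R : ℝ}
    (hg : 𝒢.vec g (basePt n) 0 ≤ R) (i j : Fin (2 * n + 2)) :
    |𝒢.vec g (Pi.single j 1) i| ≤ 2 * R := by
  have hm := hmem g⁻¹ _ (basePt_mem n)
  have h1 := 𝒢.vec_apply_sq_le g (Pi.single j 1) i
  have h2 := abs_coord_le hm j
  have h3 := one_le_zero_coord hm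
  rw [𝒢.vec_inv_basePt_zero] at h2 h3
  rw [lorentz_single_right, lorentz_single_right, mul_pow, sgn_sq, one_mul, Pi.single_eq_same,
    mul_one] at h1
  have h4 := sgn_le_one n j
  have h5 : (𝒢.vec g⁻¹ (basePt n) j) ^ 2 ≤ R ^ 2 := sq_le_sq' (by linarith [(abs_le.1 h2).1])
    (by linarith [(abs_le.1 h2).2])
  exact abs_le_of_sq_le_sq (by nlinarith) (by linarith)

/-! ### Point reflections -/

/-- The reflection of hyperbolic space in one of its points `w`. -/
def pointReflection {n : ℕ} (w : Mink n) : Module.End ℝ (Mink n) where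
  toFun y := -y - (2 * lorentz y w) • w
  map_add' x y := by rw [lorentz_add_left]; module
  map_smul' c x := by rw [lorentz_smul_left, RingHom.id_apply]; module

theorem pointReflection_apply {n : ℕ} (w y : Mink n) :
    pointReflection w y = -y - (2 * lorentz y w) • w := rfl

theorem lorentz_pointReflection {n : ℕ} {w : Mink n} (hw : lorentz w w = -1) (x y : Mink n) :
    lorentz (pointReflection w x) (pointReflection w y) = lorentz x y := by
  simp only [pointReflection_apply, lorentz_sub_left, lorentz_sub_right, lorentz_neg_left,
    lorentz_neg_right, lorentz_smul_left, lorentz_smul_right, hw, lorentz_comm w y]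
  ring

theorem pointReflection_mem {n : ℕ} {w x : Mink n} (hw : w ∈ hyperboloid n)
    (hx : x ∈ hyperboloid n) : pointReflection w x ∈ hyperboloid n := by
  refine mem_hyperboloid_of_lorentz_neg hw (by rw [lorentz_pointReflection hw.1, hx.1]) ?_
  have := one_le_neg_lorentz hw hx
  rw [pointReflection_apply, lorentz_sub_right, lorentz_neg_right, lorentz_smul_right, hw.1,
    lorentz_comm x w]
  linarith

theorem pointReflection_mul_self {n : ℕ} {w : Mink n} (hw : lorentz w w = -1) :
    pointReflection w * pointReflection w = 1 := by
  refine LinearMap.ext fun x => ?_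
  simp only [Module.End.mul_apply, Module.End.one_apply]
  rw [pointReflection_apply w (pointReflection w x), pointReflection_apply, lorentz_sub_left,
    lorentz_neg_left, lorentz_smul_left, hw]
  module

/-- The reflection is `-1` times a rank one perturbation of the identity, in even dimension `2n +
2`, so the determinant is `1 + 2 ⟨w, w⟩`. -/
theorem det_pointReflection {n : ℕ} {w : Mink n} (hw : lorentz w w = -1) :
    LinearMap.det (pointReflection w) = -1 := by
  have h : LinearMap.toMatrix' (pointReflection w) = (-1 : ℝ) • (1 + Matrix.replicateCol Unit w *
      Matrix.replicateRow Unit (fun i => 2 * (sgn n i * w i))) := by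
    ext i j
    rw [LinearMap.toMatrix'_apply, pointReflection_apply, lorentz_comm, lorentz_single_right]
    simp [Matrix.mul_apply, Matrix.one_apply, Pi.single_apply]
    ring
  rw [← LinearMap.det_toMatrix', h, Matrix.det_smul, Matrix.det_one_add_replicateCol_mul_replicateRow]
  have h2 : (fun i => 2 * (sgn n i * w i)) ⬝ᵥ w = 2 * lorentz w w := by
    rw [dotProduct, lorentz, Finset.mul_sum]
    exact Finset.sum_congr rfl fun i _ => by ring
  rw [h2, hw, Fintype.card_fin, Even.neg_one_pow ⟨n + 1, by ring⟩]
  norm_num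

/-- The midpoint of `e₀` and a point of the hyperboloid. -/
def midpt {n : ℕ} (x : Mink n) : Mink n := (√(2 + 2 * x 0))⁻¹ • (x + basePt n)

theorem lorentz_midpt {n : ℕ} {x : Mink n} (hx : x ∈ hyperboloid n) :
    lorentz (midpt x) (midpt x) = -1 := by
  have h0 : (0 : ℝ) < 2 + 2 * x 0 := by linarith [hx.2]
  rw [midpt, lorentz_smul_left, lorentz_smul_right, lorentz_add_left, lorentz_add_right,
    lorentz_add_right, hx.1, lorentz_comm x, lorentz_basePt, (basePt_mem n).1, ← mul_assoc,
    ← mul_inv, Real.mul_self_sqrt h0.le]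
  have h1 : (2 + 2 * x 0)⁻¹ * (2 + 2 * x 0) = 1 := inv_mul_cancel₀ h0.ne'
  linear_combination -h1

theorem midpt_mem {n : ℕ} {x : Mink n} (hx : x ∈ hyperboloid n) : midpt x ∈ hyperboloid n := by
  refine mem_hyperboloid_of_lorentz_neg (basePt_mem n) (lorentz_midpt hx) ?_
  have h0 : (0 : ℝ) < 2 + 2 * x 0 := by linarith [hx.2]
  have h1 : 0 < (√(2 + 2 * x 0))⁻¹ := inv_pos.2 (Real.sqrt_pos.2 h0)
  have h2 := hx.2
  rw [lorentz_basePt, midpt]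
  simp only [Pi.smul_apply, Pi.add_apply, smul_eq_mul, basePt, Pi.single_eq_same]
  have : 0 < (√(2 + 2 * x 0))⁻¹ * (x 0 + 1) := by positivity
  linarith

theorem pointReflection_midpt_basePt {n : ℕ} {x : Mink n} (hx : x ∈ hyperboloid n) :
    pointReflection (midpt x) (basePt n) = x := by
  have h0 : (0 : ℝ) < 2 + 2 * x 0 := by linarith [hx.2]
  rw [pointReflection_apply, lorentz_basePt, midpt, smul_smul]
  simp only [Pi.smul_apply, Pi.add_apply, smul_eq_mul, basePt, Pi.single_eq_same]
  have : 2 * -((√(2 + 2 * x 0))⁻¹ * (x 0 + 1)) * (√(2 + 2 * x 0))⁻¹ = -1 := by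
    have h3 := Real.mul_self_sqrt h0.le
    have h4 : (√(2 + 2 * x 0))⁻¹ * √(2 + 2 * x 0) = 1 :=
      inv_mul_cancel₀ (Real.sqrt_pos.2 h0).ne'
    set c := √(2 + 2 * x 0)
    linear_combination c⁻¹ ^ 2 * h3 - (c⁻¹ * c + 1) * h4
  rw [this]; module

/-! ### The action of `SO⁰(d,1)` on hyperbolic space -/

theorem soModel_vec {n : ℕ} (g : (soModel n).G) (x : Mink n) :
    (soModel n).vec g x = (g : SO0 n).1.1.mulVec x := Matrix.toLin'_apply _ _

/-- `SO⁰(d,1)` as a group of matrices. -/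
def soToMatrix (n : ℕ) : (soModel n).G →* Matrix (Fin (2 * n + 2)) (Fin (2 * n + 2)) ℝ :=
  show SO0 n →* _ from
    { toFun := fun g => g.1.1, map_one' := rfl, map_mul' := fun _ _ => rfl }

/-- Transitivity: reflecting in `e₀` and then in the midpoint of `e₀` and `x` takes `e₀` to `x`, and
the two determinants `-1` cancel. Discreteness: the displacement of `e₀` bounds all matrix entries
of `γ` and `γ⁻¹`. -/
theorem soModel_isGeometric (n : ℕ) : (soModel n).IsGeometric where
  vec_mem g x hx := by
    rw [soModel_vec]; exact (g.2.2 x).2 hx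
  transitive x hx := by
    set A := pointReflection (midpt x) * pointReflection (basePt n) with hA
    set B := pointReflection (basePt n) * pointReflection (midpt x) with hB
    have hm := midpt_mem hx
    have hb := basePt_mem n
    have hBA : B * A = 1 := by
      rw [hA, hB, mul_assoc, ← mul_assoc (pointReflection (midpt x)),
        pointReflection_mul_self hm.1, one_mul, pointReflection_mul_self hb.1]
    have hmul : ∀ y, (LinearMap.toMatrix' A).mulVec y = A y := fun y => by
      rw [← Matrix.toLin'_apply, Matrix.toLin'_toMatrix']
    refine ⟨(⟨⟨LinearMap.toMatrix' A, ?_⟩, fun y z => ?_, fun y => ⟨fun h => ?_, fun h => ?_⟩⟩ :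
      SO0 n), ?_⟩
    · rw [LinearMap.det_toMatrix', hA, map_mul, det_pointReflection hm.1,
        det_pointReflection hb.1]
      norm_num
    · rw [hmul, hmul, hA, Module.End.mul_apply, Module.End.mul_apply,
        lorentz_pointReflection hm.1, lorentz_pointReflection hb.1]
    · have h2 : B (A y) ∈ hyperboloid n := by
        rw [← hmul]; exact pointReflection_mem hb (pointReflection_mem hm h)
      rwa [← Module.End.mul_apply, hBA] at h2
    · rw [hmul]; exact pointReflection_mem hm (pointReflection_mem hb h)
    · refine (soModel_vec _ _).trans ?_
      change (LinearMap.toMatrix' A).mulVec _ = _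
      rw [hmul, hA, Module.End.mul_apply]
      have : pointReflection (basePt n) (basePt n) = basePt n := by
        rw [pointReflection_apply, (basePt_mem n).1]; module
      rw [this, pointReflection_midpt_basePt hx]
  continuous_vec := by
    have h : Continuous fun g : SO0 n => g.1.1 :=
      continuous_subtype_val.comp continuous_subtype_val
    have h2 : Continuous fun g : SO0 n => g.1.1.mulVec (basePt n) 0 :=
      (continuous_apply 0).comp (h.matrix_mulVec continuous_const)
    simp only [soModel_vec]
    exact h2
  continuous_mul_left a := continuous_const_mul (M := SO0 n) a
  finite_of_discrete Γ hΓ R := by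
    have hmem : ∀ g : (soModel n).G, ∀ x ∈ hyperboloid n, (soModel n).vec g x ∈ hyperboloid n :=
      fun g x hx => by rw [soModel_vec]; exact (g.2.2 x).2 hx
    have hind : Topology.IsInducing (soToMatrix n) :=
      (Topology.IsInducing.subtypeVal (t := {A : Matrix (Fin (2 * n + 2)) (Fin (2 * n + 2)) ℝ |
        A.det = 1})).comp Topology.IsInducing.subtypeVal
    have hentry : ∀ (g : (soModel n).G) i j,
        soToMatrix n g i j = (soModel n).vec g (Pi.single j 1) i := fun g i j => by
      rw [soModel_vec, Matrix.mulVec_single_one]; rfl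
    refine (finite_of_inducing (soToMatrix n) hind Γ hΓ (2 * R)).subset fun γ hγ => ⟨?_, ?_⟩
    · intro i j
      rw [hentry]; exact (soModel n).abs_vec_single_le hmem hγ i j
    · intro i j
      rw [hentry]
      refine (soModel n).abs_vec_single_le hmem ?_ i j
      rw [Subgroup.coe_inv, (soModel n).vec_inv_basePt_zero]
      exact hγ

open CliffordAlgebra

/-! ### The Clifford algebra of Minkowski space -/

section Clifford

variable {n : ℕ}

theorem polar_lorentzQ (x y : Mink n) : QuadraticMap.polar (lorentzQ n) x y = 2 * lorentz x y := by
  rw [QuadraticMap.polar, lorentzQ_apply, lorentzQ_apply, lorentzQ_apply, lorentz_add_left,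
    lorentz_add_right, lorentz_add_right, lorentz_comm y x]
  ring

/-- The basis of the Clifford algebra given by the products of the basis vectors, as transported
from the exterior algebra. -/
def cliffordBasis (n : ℕ) :
    Module.Basis (Finset (Fin (2 * n + 2))) ℝ (CliffordAlgebra (lorentzQ n)) :=
  (Pi.basisFun ℝ (Fin (2 * n + 2))).ExteriorAlgebra.map (equivExterior (lorentzQ n)).symm

instance : Module.Finite ℝ (CliffordAlgebra (lorentzQ n)) := .of_basis (cliffordBasis n)

/-- The generators of the Clifford algebra. -/
def cl (n : ℕ) (i : Fin (2 * n + 2)) : CliffordAlgebra (lorentzQ n) := ι _ (Pi.single i 1)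

theorem lorentz_single_single (i j : Fin (2 * n + 2)) :
    lorentz (Pi.single i 1 : Mink n) (Pi.single j 1) = if i = j then sgn n i else 0 := by
  rw [lorentz_single_right]
  split_ifs with h
  · subst h; simp
  · simp [Ne.symm h]

theorem cl_sq (i : Fin (2 * n + 2)) : cl n i * cl n i = algebraMap ℝ _ (sgn n i) := by
  rw [cl, ι_sq_scalar, lorentzQ_apply, lorentz_single_single, if_pos rfl]

theorem cl_mul_cl {i j : Fin (2 * n + 2)} (h : i ≠ j) : cl n i * cl n j = -(cl n j * cl n i) :=
  ι_mul_ι_of_orthogonal (by rw [lorentz_single_single, if_neg h])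

theorem ι_eq_sum_cl (v : Mink n) : ι (lorentzQ n) v = ∑ i, v i • cl n i := by
  conv_lhs => rw [pi_eq_sum_univ' v]
  rw [map_sum]
  refine Finset.sum_congr rfl fun i _ => ?_
  rw [map_smul]
  congr 2

/-- There is a positive definite bilinear form on the Clifford algebra that is invariant under left
multiplication by the generators. -/
theorem exists_invariant_form (s : Finset (Fin (2 * n + 2))) :
    ∃ B : CliffordAlgebra (lorentzQ n) →ₗ[ℝ] CliffordAlgebra (lorentzQ n) →ₗ[ℝ] ℝ,
      (∀ x k, ((cliffordBasis n).repr x k) ^ 2 ≤ B x x) ∧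
      ∀ i ∈ s, ∀ x y, B (cl n i * x) (cl n i * y) = B x y := by
  induction s using Finset.induction_on with
  | empty =>
    refine ⟨∑ k, (LinearMap.mul ℝ ℝ).compl₁₂ ((cliffordBasis n).coord k)
      ((cliffordBasis n).coord k), fun x k => ?_, by simp⟩
    simp only [LinearMap.sum_apply, LinearMap.compl₁₂_apply, LinearMap.mul_apply',
      Module.Basis.coord_apply, ← pow_two]
    exact Finset.single_le_sum (f := fun k => ((cliffordBasis n).repr x k) ^ 2)
      (fun _ _ => sq_nonneg _) (Finset.mem_univ k)
  | insert j s hj ih =>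
    obtain ⟨B, hpos, hB⟩ := ih
    -- Averaging over `1` and `e_j`: this is invariant under `e_j` because `e_j² = ±1`, and the
    -- earlier invariances survive because the generators anticommute.
    refine ⟨B + B.compl₁₂ (LinearMap.mulLeft ℝ (cl n j)) (LinearMap.mulLeft ℝ (cl n j)),
      fun x k => ?_, fun i hi x y => ?_⟩
    · have h1 := hpos x k
      have h2 := (sq_nonneg _).trans (hpos (cl n j * x) k)
      simpa using h1.trans (le_add_of_nonneg_right h2)
    · simp only [LinearMap.add_apply, LinearMap.compl₁₂_apply, LinearMap.mulLeft_apply]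
      by_cases hij : i = j
      · subst hij
        rw [← mul_assoc, ← mul_assoc, cl_sq, ← Algebra.smul_def, ← Algebra.smul_def, map_smul,
          map_smul, LinearMap.smul_apply, smul_smul, ← pow_two, sgn_sq, one_smul, add_comm]
      · have his : i ∈ s := (Finset.mem_insert.1 hi).resolve_left hij
        rw [hB i his, ← mul_assoc, ← mul_assoc, cl_mul_cl (Ne.symm hij), neg_mul, neg_mul, map_neg,
          map_neg, LinearMap.neg_apply, neg_neg, mul_assoc, mul_assoc, hB i his]

theorem cl0_eq : cl0 n = cl n 0 := rfl

/-- With respect to an invariant form, the adjoint of left multiplication by `x` is left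
multiplication by `-e₀ x* e₀`. -/
theorem invariant_form_adjoint
    {B : CliffordAlgebra (lorentzQ n) →ₗ[ℝ] CliffordAlgebra (lorentzQ n) →ₗ[ℝ] ℝ}
    (hB : ∀ i x y, B (cl n i * x) (cl n i * y) = B x y) (x y z : CliffordAlgebra (lorentzQ n)) :
    B (x * y) z = B y (-(cl0 n * star x * cl0 n) * z) := by
  -- Each generator is its own adjoint up to the sign of its square; `hconj` produces the same sign
  -- by conjugation with `e₀`.
  have hcl : ∀ i y z, B (cl n i * y) z = B y (sgn n i • (cl n i * z)) := fun i y z => by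
    rw [← hB i y, mul_smul_comm, ← mul_assoc, cl_sq, ← Algebra.smul_def, smul_smul, ← pow_two,
      sgn_sq, one_smul]
  have hconj : ∀ i, cl0 n * cl n i * cl0 n = sgn n i • cl n i := fun i => by
    by_cases hi : i = 0
    · subst hi
      rw [cl0_eq, cl_sq, ← Algebra.smul_def]
    · rw [cl0_eq, mul_assoc, cl_mul_cl hi, mul_neg, ← mul_assoc, cl_sq, ← Algebra.smul_def]
      simp [sgn, hi]
  induction x using CliffordAlgebra.induction generalizing y z with
  | algebraMap r =>
    rw [star_algebraMap, ← Algebra.commutes, mul_assoc, cl0_sq]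
    simp [← Algebra.smul_def]
  | ι v =>
    rw [star_ι, ι_eq_sum_cl]
    simp only [mul_neg, neg_mul, neg_neg, Finset.sum_mul, Finset.mul_sum, map_sum, LinearMap.sum_apply, smul_mul_assoc,
      mul_smul_comm, map_smul, LinearMap.smul_apply, hcl, hconj]
  | mul a b ha hb =>
    rw [mul_assoc, ha, hb, ← mul_assoc, star_mul]
    congr 2
    calc -(cl0 n * star b * cl0 n) * -(cl0 n * star a * cl0 n)
        = cl0 n * star b * (cl0 n * cl0 n) * star a * cl0 n := by noncomm_ring
      _ = -(cl0 n * (star b * star a) * cl0 n) := by rw [cl0_sq]; noncomm_ring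
  | add a b ha hb =>
    rw [add_mul, map_add, LinearMap.add_apply, ha, hb, ← map_add, star_add]
    congr 1
    noncomm_ring

theorem spin_star_mul_cl0_mul (g : spinGroup (lorentzQ n)) :
    star (g : CliffordAlgebra (lorentzQ n)) * cl0 n * (g : CliffordAlgebra (lorentzQ n)) =
      ι _ (spinVec n g⁻¹ (basePt n)) := by
  change _ = ι _ (spinVecMap g⁻¹ (basePt n))
  rw [ι_spinVecMap, ← spinGroup.star_eq_inv, spinGroup.coe_star, star_star]
  rfl

end Clifford

/-! ### The action of `Spin(d,1)` on hyperbolic space -/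

section Spin

variable {n : ℕ}

/-- For an invariant form, `B(g, g) = -B(1, e₀ g* e₀ g)`, and `g* e₀ g` is the vector `g⁻¹ e₀`. The
squared coefficients of `g` are thus bounded by a linear function of the coordinates of `g⁻¹ e₀`. -/
theorem abs_repr_spin_le (n : ℕ) : ∃ C : ℝ, ∀ (g : spinGroup (lorentzQ n)) (R : ℝ),
    spinVec n g⁻¹ (basePt n) ∈ hyperboloid n → spinVec n g⁻¹ (basePt n) 0 ≤ R →
      ∀ k, |(cliffordBasis n).repr g.1 k| ≤ √(R * C) := by
  obtain ⟨B, hpos, hB⟩ := exists_invariant_form (n := n) Finset.univ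
  refine ⟨∑ i, |B 1 (cl0 n * cl n i)|, fun g R hm hR k => Real.abs_le_sqrt ?_⟩
  refine (hpos g.1 k).trans ?_
  have h1 : B g.1 g.1 = -B 1 (cl0 n * ι _ (spinVec n g⁻¹ (basePt n))) := by
    conv_lhs => rw [← mul_one g.1]
    rw [mul_one]
    nth_rewrite 1 [← mul_one g.1]
    rw [invariant_form_adjoint (fun i => hB i (Finset.mem_univ i)), ← spin_star_mul_cl0_mul,
      neg_mul, map_neg, mul_assoc, mul_assoc, mul_assoc]
  rw [h1, ι_eq_sum_cl, Finset.mul_sum, map_sum, ← Finset.sum_neg_distrib, Finset.mul_sum]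
  refine Finset.sum_le_sum fun i _ => ?_
  rw [mul_smul_comm, map_smul, smul_eq_mul]
  refine (neg_le_abs _).trans ?_
  rw [abs_mul]
  exact mul_le_mul_of_nonneg_right ((abs_coord_le hm i).trans hR) (abs_nonneg _)

/-- The interior of the future light cone. -/
def futureCone (n : ℕ) : Set (Mink n) := {x | lorentz x x < 0 ∧ 0 < x 0}

/-- The reflection in `v` exchanges the two cones exactly when `v` is timelike, and then the factor
`⟨v, v⟩` is negative as well, so the signs cancel. Keeping this factor treats timelike and spacelike
`v` together. -/
theorem reflection_mem_futureCone {v x : Mink n} (hv : lorentz v v ≠ 0) (hx : x ∈ futureCone n) :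
    lorentz v v • x - (2 * lorentz v x) • v ∈ futureCone n := by
  obtain ⟨hxx, hx0⟩ := hx
  refine ⟨?_, ?_⟩
  · simp only [lorentz_sub_left, lorentz_sub_right, lorentz_smul_left, lorentz_smul_right,
      lorentz_comm x v]
    have : 0 < lorentz v v ^ 2 := by positivity
    nlinarith
  · rw [lorentz_self] at hxx hv
    have hc := sq_sum_succ_le v x
    simp only [Pi.sub_apply, Pi.smul_apply, smul_eq_mul]
    rw [lorentz_self, lorentz_eq_sum_succ v x]
    set p := ∑ i : Fin (2 * n + 1), v i.succ ^ 2
    set q := ∑ i : Fin (2 * n + 1), x i.succ ^ 2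
    set r := ∑ i : Fin (2 * n + 1), v i.succ * x i.succ
    have hp : 0 ≤ p := Finset.sum_nonneg fun i _ => sq_nonneg _
    have hq : 0 ≤ q := Finset.sum_nonneg fun i _ => sq_nonneg _
    have hpv : 0 < p + v 0 ^ 2 := by
      rcases hp.lt_or_eq with h | h
      · positivity
      · have : v 0 ^ 2 ≠ 0 := fun h0 => hv (by rw [h0, ← h]; simp)
        positivity
    have hne : p - v 0 ^ 2 ≠ 0 := fun h0 => hv (by linarith)
    suffices h : 2 * r * v 0 < x 0 * (p + v 0 ^ 2) by linarith
    refine lt_of_le_of_lt (le_abs_self _) (abs_lt_of_sq_lt_sq ?_ (by positivity))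
    calc (2 * r * v 0) ^ 2 = 4 * r ^ 2 * v 0 ^ 2 := by ring
      _ ≤ 4 * (p * q) * v 0 ^ 2 := by gcongr
      _ ≤ 4 * (p * x 0 ^ 2) * v 0 ^ 2 := by gcongr; linarith
      _ < (x 0 * (p + v 0 ^ 2)) ^ 2 := by
        have : 0 < x 0 ^ 2 * (p - v 0 ^ 2) ^ 2 := by positivity
        nlinarith

theorem lorentz_ne_zero_of_isUnit {v : Mink n} (h : IsUnit (ι (lorentzQ n) v)) :
    lorentz v v ≠ 0 := fun h0 => by
  have h1 := ι_sq_scalar (lorentzQ n) v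
  rw [lorentzQ_apply, h0, map_zero] at h1
  exact (h.mul h).ne_zero h1

/-- Conjugation by an element of the Lipschitz group preserves the future cone, up to a positive
factor that is absorbed by the cone. -/
theorem lipschitz_conj_futureCone {u : (CliffordAlgebra (lorentzQ n))ˣ}
    (hu : u ∈ lipschitzGroup (lorentzQ n)) {x : Mink n} (hx : x ∈ futureCone n) :
    ∃ y ∈ futureCone n, (u : CliffordAlgebra (lorentzQ n)) * ι _ x *
      star (u : CliffordAlgebra (lorentzQ n)) = ι _ y := by
  have hgen : ∀ (v : Mink n), lorentz v v ≠ 0 → ∀ x ∈ futureCone n, ∃ y ∈ futureCone n,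
      ι (lorentzQ n) v * ι _ x * star (ι (lorentzQ n) v) = ι _ y := fun v hv x hx => by
    refine ⟨_, reflection_mem_futureCone hv hx, ?_⟩
    rw [star_ι, mul_neg, ι_mul_ι_mul_ι, polar_lorentzQ, lorentzQ_apply, ← map_neg, neg_sub]
  -- The claim is paired with the one for `u⁻¹` so that the closure induction passes through
  -- inverses.
  suffices h : (∀ x ∈ futureCone n, ∃ y ∈ futureCone n, (u : CliffordAlgebra (lorentzQ n)) * ι _ x *
      star (u : CliffordAlgebra (lorentzQ n)) = ι _ y) ∧ ∀ x ∈ futureCone n, ∃ y ∈ futureCone n,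
      ((u⁻¹ : (CliffordAlgebra (lorentzQ n))ˣ) : CliffordAlgebra (lorentzQ n)) * ι _ x *
      star ((u⁻¹ : (CliffordAlgebra (lorentzQ n))ˣ) : CliffordAlgebra (lorentzQ n)) = ι _ y from
    h.1 x hx
  have hmul : ∀ a b : (CliffordAlgebra (lorentzQ n)),
      (∀ x ∈ futureCone n, ∃ y ∈ futureCone n, a * ι _ x * star a = ι _ y) →
      (∀ x ∈ futureCone n, ∃ y ∈ futureCone n, b * ι _ x * star b = ι _ y) →
      ∀ x ∈ futureCone n, ∃ y ∈ futureCone n, (a * b) * ι _ x * star (a * b) = ι _ y :=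
    fun a b ha hb x hx => by
      obtain ⟨y, hy, hxy⟩ := hb x hx
      obtain ⟨z, hz, hyz⟩ := ha y hy
      refine ⟨z, hz, ?_⟩
      rw [← hyz, ← hxy, star_mul]
      simp only [mul_assoc]
  induction hu using Subgroup.closure_induction with
  | mem u hu =>
    obtain ⟨v, hv⟩ := hu
    have hv0 : lorentz v v ≠ 0 := lorentz_ne_zero_of_isUnit (hv ▸ u.isUnit)
    have hinv : ((u⁻¹ : (CliffordAlgebra (lorentzQ n))ˣ) : CliffordAlgebra (lorentzQ n)) =
        ι _ ((lorentz v v)⁻¹ • v) := by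
      rw [Units.inv_eq_of_mul_eq_one_right]
      rw [← hv, map_smul, mul_smul_comm, ι_sq_scalar, lorentzQ_apply, Algebra.smul_def, ← map_mul,
        inv_mul_cancel₀ hv0, map_one]
    rw [hinv, ← hv]
    refine ⟨hgen v hv0, hgen _ ?_⟩
    rw [lorentz_smul_left, lorentz_smul_right]
    have := inv_ne_zero hv0
    positivity
  | one => exact ⟨fun x hx => ⟨x, hx, by simp⟩, fun x hx => ⟨x, hx, by simp⟩⟩
  | mul a b _ _ ha hb =>
    rw [mul_inv_rev, Units.val_mul, Units.val_mul]
    exact ⟨hmul _ _ ha.1 hb.1, hmul _ _ hb.2 ha.2⟩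
  | inv a _ ha =>
    rw [inv_inv]
    exact ⟨ha.2, ha.1⟩

theorem spinVec_mem (g : spinGroup (lorentzQ n)) {x : Mink n} (hx : x ∈ hyperboloid n) :
    spinVec n g x ∈ hyperboloid n := by
  obtain ⟨u, hu, hug⟩ := spinGroup.mem_pin g.2 |>.1
  obtain ⟨y, hy, hxy⟩ := lipschitz_conj_futureCone hu (x := x) ⟨by rw [hx.1]; norm_num, hx.2⟩
  have h : spinVec n g x = y := by
    apply cliffordι_injective n
    rw [← hxy]
    change ι _ (spinVecMap g x) = _
    rw [ι_spinVecMap, ← hug]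
    rfl
  refine ⟨?_, h ▸ hy.2⟩
  have := (spinModel n).lorentz_vec g x
  exact this.trans hx.1

/-- The lift to the Clifford algebra of the product of two point reflections: the element `w e₀`,
with `w` the midpoint. -/
theorem exists_spinVec_eq {x : Mink n} (hx : x ∈ hyperboloid n) :
    ∃ g : spinGroup (lorentzQ n), spinVec n g (basePt n) = x := by
  set w := midpt x
  have hw : lorentz w w = -1 := lorentz_midpt hx
  have hQ : ι (lorentzQ n) w * ι (lorentzQ n) w = -1 := by
    rw [ι_sq_scalar, lorentzQ_apply, hw, map_neg, map_one]
  have hstar : star (ι (lorentzQ n) w * cl0 n) = cl0 n * ι (lorentzQ n) w := by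
    rw [star_mul, cl0, star_ι, star_ι, neg_mul_neg]
  obtain ⟨u0, hu0⟩ := isUnit_ι_of_isUnit (lorentzQ n) (m := basePt n)
    (by rw [lorentzQ_apply, (basePt_mem n).1]; exact isUnit_one.neg)
  obtain ⟨u1, hu1⟩ := isUnit_ι_of_isUnit (lorentzQ n) (m := w)
    (by rw [lorentzQ_apply, hw]; exact isUnit_one.neg)
  have hmem : ι (lorentzQ n) w * cl0 n ∈ spinGroup (lorentzQ n) := by
    refine ⟨⟨⟨u1 * u0, mul_mem (Subgroup.subset_closure ⟨_, hu1.symm⟩)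
      (Subgroup.subset_closure ⟨_, hu0.symm⟩), ?_⟩, ?_, ?_⟩, ι_mul_ι_mem_evenOdd_zero _ _ _⟩
    · simp [hu0, hu1, cl0, basePt]
    · rw [hstar, mul_assoc, ← mul_assoc (ι _ w), hQ, neg_one_mul, mul_neg, cl0_sq, neg_neg]
    · rw [hstar, mul_assoc, ← mul_assoc (cl0 n), cl0_sq, neg_one_mul, mul_neg, hQ, neg_neg]
  refine ⟨⟨_, hmem⟩, cliffordι_injective n ?_⟩
  change ι _ (spinVecMap _ _) = _
  rw [ι_spinVecMap]
  change ι (lorentzQ n) w * cl0 n * cl0 n * star (ι (lorentzQ n) w * cl0 n) = _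
  rw [hstar, mul_assoc _ (cl0 n) (cl0 n), cl0_sq, mul_neg_one, neg_mul, ← mul_assoc]
  change -(ι (lorentzQ n) w * ι _ (basePt n) * ι (lorentzQ n) w) = _
  rw [ι_mul_ι_mul_ι, ← map_neg, ← pointReflection_midpt_basePt hx, polar_lorentzQ, lorentzQ_apply,
    hw, pointReflection_apply, lorentz_comm w (basePt n)]
  congr 1
  module

/-- The module topology of a finite-dimensional space is induced by any injective linear map to a
matrix space. -/
theorem moduleTopology_eq_induced {E ι : Type*} [AddCommGroup E] [Module ℝ E] [Finite ι]
    (f : E →ₗ[ℝ] Matrix ι ι ℝ) (hf : Function.Injective f) :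
    moduleTopology ℝ E = TopologicalSpace.induced f inferInstance := by
  let _ : TopologicalSpace E := moduleTopology ℝ E
  have : IsModuleTopology ℝ E := ⟨rfl⟩
  have := IsModuleTopology.toContinuousAdd ℝ E
  have : IsModuleTopology ℝ (Matrix ι ι ℝ) := inferInstanceAs (IsModuleTopology ℝ (ι → ι → ℝ))
  obtain ⟨ψ, hψ⟩ := f.exists_leftInverse_of_injective (LinearMap.ker_eq_bot.2 hf)
  have hl : Function.LeftInverse ψ f := fun x => by
    rw [← LinearMap.comp_apply, hψ, LinearMap.id_apply]
  exact (hl.isEmbedding (IsModuleTopology.continuous_of_linearMap ψ)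
    (IsModuleTopology.continuous_of_linearMap f)).eq_induced

/-- `Spin(d,1)` acting by left multiplication on the Clifford algebra, as a group of matrices. -/
def spinToMatrix (n : ℕ) : (spinModel n).G →*
    Matrix (Finset (Fin (2 * n + 2))) (Finset (Fin (2 * n + 2))) ℝ :=
  show spinGroup (lorentzQ n) →* _ from
    (Algebra.leftMulMatrix (cliffordBasis n)).toMonoidHom.comp (spinGroup (lorentzQ n)).subtype

theorem spinToMatrix_apply (g : spinGroup (lorentzQ n)) (i j : Finset (Fin (2 * n + 2))) :
    spinToMatrix n g i j = (cliffordBasis n).repr (g.1 * cliffordBasis n j) i :=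
  Algebra.leftMulMatrix_eq_repr_mul _ _ _ _

theorem isInducing_spinToMatrix (n : ℕ) : Topology.IsInducing (spinToMatrix n) := by
  refine ⟨?_⟩
  change TopologicalSpace.induced Subtype.val (moduleTopology ℝ (CliffordAlgebra (lorentzQ n))) = _
  rw [moduleTopology_eq_induced (Algebra.leftMulMatrix (cliffordBasis n)).toLinearMap
    (Algebra.leftMulMatrix_injective _), induced_compose]
  rfl

/-- For discreteness the group is embedded by left multiplication on the Clifford algebra. Bounded
coefficients of `g` give bounded matrix entries, `D` being the sum of the absolute values of all
structure constants. -/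
theorem spinModel_isGeometric (n : ℕ) : (spinModel n).IsGeometric where
  vec_mem g x hx := spinVec_mem g hx
  transitive x hx := exists_spinVec_eq hx
  continuous_vec := by
    let _ : TopologicalSpace (CliffordAlgebra (lorentzQ n)) := moduleTopology ℝ _
    have : IsModuleTopology ℝ (CliffordAlgebra (lorentzQ n)) := ⟨rfl⟩
    have := IsModuleTopology.isTopologicalRing ℝ (CliffordAlgebra (lorentzQ n))
    obtain ⟨ψ, hψ⟩ := (ι (lorentzQ n)).exists_leftInverse_of_injective
      (LinearMap.ker_eq_bot.2 (cliffordι_injective n))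
    have hl : ∀ x, ψ (ι (lorentzQ n) x) = x := fun x => by
      rw [← LinearMap.comp_apply, hψ, LinearMap.id_apply]
    let S : CliffordAlgebra (lorentzQ n) →ₗ[ℝ] CliffordAlgebra (lorentzQ n) :=
      { toFun := star, map_add' := star_add, map_smul' := CliffordAlgebra.star_smul }
    have hS : Continuous S := IsModuleTopology.continuous_of_linearMap S
    have hψc : Continuous ((LinearMap.proj 0 : Mink n →ₗ[ℝ] ℝ) ∘ₗ ψ) :=
      IsModuleTopology.continuous_of_linearMap _
    have hval : Continuous (fun g : (spinModel n).G => (show spinGroup (lorentzQ n) from g).1) :=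
      continuous_induced_dom
    have hconj : Continuous fun g : (spinModel n).G =>
        (show spinGroup (lorentzQ n) from g).1 * cl0 n * S (show spinGroup (lorentzQ n) from g).1 :=
      (hval.mul continuous_const).mul (hS.comp hval)
    refine (hψc.comp hconj).congr fun g => ?_
    exact congrArg (fun y : Mink n => y 0)
      ((congrArg ψ (ι_spinVecMap g (basePt n))).symm.trans (hl (spinVecMap g (basePt n))))
  continuous_mul_left a := by
    rw [(isInducing_spinToMatrix n).continuous_iff]
    have : spinToMatrix n ∘ (fun g => a * g) = fun g => spinToMatrix n a * spinToMatrix n g :=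
      funext fun g => map_mul _ _ _
    rw [this]
    exact continuous_const.mul (isInducing_spinToMatrix n).continuous
  finite_of_discrete Γ hΓ R := by
    obtain ⟨C, hC⟩ := abs_repr_spin_le n
    set b := cliffordBasis n with hb
    set D : ℝ := ∑ i, ∑ j, ∑ k, |b.repr (b k * b j) i| with hD
    have hle : ∀ i j, ∑ k, |b.repr (b k * b j) i| ≤ D := fun i j => by
      refine (Finset.single_le_sum (f := fun j => ∑ k, |b.repr (b k * b j) i|)
        (fun _ _ => Finset.sum_nonneg fun _ _ => abs_nonneg _) (Finset.mem_univ j)).trans ?_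
      exact Finset.single_le_sum (f := fun i => ∑ j, ∑ k, |b.repr (b k * b j) i|)
        (fun _ _ => Finset.sum_nonneg fun _ _ => Finset.sum_nonneg fun _ _ => abs_nonneg _)
        (Finset.mem_univ i)
    have hentry : ∀ g : spinGroup (lorentzQ n), spinVec n g⁻¹ (basePt n) 0 ≤ R →
        ∀ i j, |spinToMatrix n g i j| ≤ √(R * C) * D := fun g hg i j => by
      have h1 := hC g R (spinVec_mem _ (basePt_mem n)) hg
      have h2 : b.repr (g.1 * b j) i = ∑ k, b.repr g.1 k * b.repr (b k * b j) i := by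
        conv_lhs => rw [← b.sum_repr g.1, Finset.sum_mul, map_sum, Finsupp.finsetSum_apply]
        refine Finset.sum_congr rfl fun k _ => ?_
        rw [smul_mul_assoc, map_smul, Finsupp.smul_apply, smul_eq_mul]
      rw [spinToMatrix_apply, ← hb, h2]
      refine (Finset.abs_sum_le_sum_abs _ _).trans ?_
      refine le_trans ?_ (mul_le_mul_of_nonneg_left (hle i j) (Real.sqrt_nonneg _))
      rw [Finset.mul_sum]
      refine Finset.sum_le_sum fun k _ => ?_
      rw [abs_mul]
      exact mul_le_mul_of_nonneg_right (h1 k) (abs_nonneg _)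
    refine (finite_of_inducing (spinToMatrix n) (isInducing_spinToMatrix n) Γ hΓ
      (√(R * C) * D)).subset fun γ hγ => ⟨hentry _ ?_, hentry _ ?_⟩
    · have := (spinModel n).vec_inv_basePt_zero (γ : (spinModel n).G)
      exact this.trans_le hγ
    · have : ((γ⁻¹ : Γ) : (spinModel n).G)⁻¹ = γ := by simp
      exact (congrArg (fun g => (spinModel n).vec g (basePt n) 0) this).trans_le hγ

end Spin

namespace LorentzModel

variable {n : ℕ} {𝒢 : LorentzModel n}

/-! ### Translation lengths -/

theorem IsGeometric.bddBelow_displacement (h𝒢 : 𝒢.IsGeometric) (g : 𝒢.G) :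
    BddBelow ((fun x => hypDist x (𝒢.vec g x)) '' hyperboloid n) :=
  ⟨0, by rintro _ ⟨x, hx, rfl⟩; exact hypDist_nonneg hx (h𝒢.vec_mem g x hx)⟩

theorem nonempty_displacement (g : 𝒢.G) :
    ((fun x => hypDist x (𝒢.vec g x)) '' hyperboloid n).Nonempty :=
  ⟨_, basePt n, basePt_mem n, rfl⟩

theorem IsGeometric.length_le (h𝒢 : 𝒢.IsGeometric) (g : 𝒢.G) {x : Mink n}
    (hx : x ∈ hyperboloid n) : 𝒢.length g ≤ hypDist x (𝒢.vec g x) :=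
  csInf_le (h𝒢.bddBelow_displacement g) ⟨x, hx, rfl⟩

theorem IsGeometric.length_nonneg (h𝒢 : 𝒢.IsGeometric) (g : 𝒢.G) : 0 ≤ 𝒢.length g :=
  le_csInf (nonempty_displacement g) (by
    rintro _ ⟨x, hx, rfl⟩; exact hypDist_nonneg hx (h𝒢.vec_mem g x hx))

theorem vec_conj_apply (g h : 𝒢.G) (x : Mink n) :
    lorentz (𝒢.vec h x) (𝒢.vec (h * g * h⁻¹) (𝒢.vec h x)) = lorentz x (𝒢.vec g x) := by
  rw [← Module.End.mul_apply (𝒢.vec (h * g * h⁻¹)), ← map_mul, inv_mul_cancel_right, map_mul,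
    Module.End.mul_apply, 𝒢.lorentz_vec_vec]

/-- The translation length of an element conjugate to `m exp (t H_ℝ)` is at most `t`. -/
theorem IsGeometric.length_le_of_isMA (h𝒢 : 𝒢.IsGeometric) {g : 𝒢.G} {p : 𝒢.M × ℝ}
    (hp : 𝒢.IsMA g p) : 𝒢.length g ≤ p.2 := by
  obtain ⟨ht, h, hh⟩ := hp
  refine (h𝒢.length_le g (h𝒢.vec_mem h _ (basePt_mem n))).trans ?_
  have hg : g = h * (p.1 * 𝒢.expH p.2) * h⁻¹ := by rw [← hh]; group
  have hm : 𝒢.vec (p.1 : 𝒢.G)⁻¹ (basePt n) = basePt n := 𝒢.K.inv_mem p.1.2.1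
  have : lorentz (𝒢.vec h (basePt n)) (𝒢.vec g (𝒢.vec h (basePt n))) = -Real.cosh p.2 := by
    rw [hg, vec_conj_apply, map_mul, Module.End.mul_apply, 𝒢.lorentz_vec_right, hm, 𝒢.vec_expH,
      lorentz_basePt, boostMap_apply_zero]
    simp [basePt]
  rw [hypDist, this, neg_neg, Real.arcosh_cosh ht.le]

/-- Only this inequality is needed. It holds for the default value too, so the existence of the
normal form `m a` never has to be proved. -/
theorem IsGeometric.length_le_maPart (h𝒢 : 𝒢.IsGeometric) (g : 𝒢.G) :
    𝒢.length g ≤ (𝒢.maPart g).2 := by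
  unfold maPart
  split_ifs with h
  · exact h𝒢.length_le_of_isMA h.choose_spec
  · exact le_rfl

/-! ### Cocompact discrete subgroups -/

variable {Γ : Subgroup 𝒢.G}

/-- A cocompact subgroup moves every point of hyperbolic space into a fixed ball. -/
theorem IsGeometric.exists_radius (h𝒢 : 𝒢.IsGeometric)
    (hΓ : CompactSpace (Quotient (QuotientGroup.rightRel Γ))) :
    ∃ R : ℝ, ∀ x ∈ hyperboloid n, ∃ γ : Γ, 𝒢.vec γ x 0 ≤ R := by
  let π : 𝒢.G → Quotient (QuotientGroup.rightRel Γ) := Quotient.mk _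
  let U : ℕ → Set 𝒢.G := fun k => {g | 𝒢.vec g (basePt n) 0 < k}
  have hU : ∀ k, IsOpen (U k) := fun k => isOpen_lt h𝒢.continuous_vec continuous_const
  have hπU : ∀ k, IsOpen (π '' U k) := fun k => by
    change IsOpen (π ⁻¹' (π '' U k))
    -- The saturation of `U k` is the union of its `Γ`-translates, so the quotient map is open on
    -- these sets.
    have : π ⁻¹' (π '' U k) = ⋃ γ : Γ, (fun g => (γ : 𝒢.G) * g) ⁻¹' U k := by
      ext g
      simp only [Set.mem_preimage, Set.mem_image, Set.mem_iUnion]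
      constructor
      · rintro ⟨a, ha, hag⟩
        have h1 : a * g⁻¹ ∈ Γ :=
          QuotientGroup.rightRel_apply.1 (Quotient.exact hag.symm)
        exact ⟨⟨_, h1⟩, by simpa using ha⟩
      · rintro ⟨γ, hγ⟩
        refine ⟨_, hγ, Quotient.sound ?_⟩
        refine (Setoid.symm' _ ?_)
        exact QuotientGroup.rightRel_apply.2 (by simp)
    rw [this]
    exact isOpen_iUnion fun γ => (hU k).preimage (h𝒢.continuous_mul_left _)
  have hmono : ∀ {k l}, k ≤ l → U k ⊆ U l := fun {k l} hkl g hg =>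
    lt_of_lt_of_le (show _ < (k : ℝ) from hg) (by exact_mod_cast hkl)
  obtain ⟨k, hk⟩ := isCompact_univ.elim_directed_cover (fun k => π '' U k) hπU
    (fun q _ => by
      obtain ⟨g, rfl⟩ := Quotient.exists_rep q
      obtain ⟨k, hk⟩ := exists_nat_gt (𝒢.vec g (basePt n) 0)
      exact Set.mem_iUnion.2 ⟨k, g, hk, rfl⟩)
    (fun k l => ⟨max k l, Set.image_mono (hmono (le_max_left _ _)),
      Set.image_mono (hmono (le_max_right _ _))⟩)
  refine ⟨k, fun x hx => ?_⟩
  obtain ⟨g, rfl⟩ := h𝒢.transitive x hx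
  obtain ⟨a, ha, hag⟩ := hk (Set.mem_univ (π g))
  have h1 : a * g⁻¹ ∈ Γ := QuotientGroup.rightRel_apply.1 (Quotient.exact hag.symm)
  refine ⟨⟨_, h1⟩, ?_⟩
  rw [← Module.End.mul_apply, ← map_mul, inv_mul_cancel_right]
  exact (show _ < (k : ℝ) from ha).le

/-- Only finitely many elements of a discrete subgroup move some point of a given ball to within a
given distance of that ball. -/
theorem IsGeometric.finite_near (h𝒢 : 𝒢.IsGeometric) (hΓ : DiscreteTopology Γ) (R C : ℝ) :
    {γ : Γ | ∃ x ∈ hyperboloid n, ∃ y ∈ hyperboloid n, x 0 ≤ R ∧ y 0 ≤ R ∧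
      -lorentz x (𝒢.vec γ y) ≤ C}.Finite := by
  -- The bound comes from two weak triangle inequalities, through `x` for `γ y` and through `y` for
  -- `γ⁻¹ e₀`.
  refine (h𝒢.finite_of_discrete Γ hΓ (2 * R * (2 * R * C))).subset ?_
  rintro γ ⟨x, hx, y, hy, hxR, hyR, hC⟩
  have h1 := zero_coord_le_mul_neg_lorentz hx (h𝒢.vec_mem γ y hy)
  have h2 := zero_coord_le_mul_neg_lorentz hy (h𝒢.vec_mem (γ : 𝒢.G)⁻¹ _ (basePt_mem n))
  rw [lorentz_comm, ← 𝒢.lorentz_vec_right, lorentz_basePt, neg_neg, 𝒢.vec_inv_basePt_zero] at h2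
  have h3 := one_le_zero_coord hx
  have h4 := one_le_zero_coord hy
  have h5 := one_le_zero_coord (h𝒢.vec_mem γ y hy)
  have h6 := one_le_neg_lorentz hx (h𝒢.vec_mem γ y hy)
  have h7 : 𝒢.vec γ y 0 ≤ 2 * R * C := h1.trans (by gcongr; linarith)
  exact h2.trans (by gcongr; linarith)

/-- All powers of `γ` would fix `x`; there are infinitely many, against proper discontinuity. -/
theorem IsGeometric.vec_ne_of_torsionFree (h𝒢 : 𝒢.IsGeometric) (hΓ : DiscreteTopology Γ)
    (htf : ∀ γ : Γ, γ ≠ 1 → ¬IsOfFinOrder γ) {γ : Γ} (hγ : γ ≠ 1) {x : Mink n}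
    (hx : x ∈ hyperboloid n) : 𝒢.vec γ x ≠ x := fun hfix => by
  have hpow : ∀ k : ℕ, 𝒢.vec ((γ ^ k : Γ) : 𝒢.G) x = x := fun k => by
    induction k with
    | zero => simp
    | succ k ih => rw [pow_succ, Subgroup.coe_mul, map_mul, Module.End.mul_apply, hfix, ih]
  have hinj : Function.Injective fun k : ℕ => γ ^ k :=
    injective_pow_iff_not_isOfFinOrder.2 (htf γ hγ)
  refine Set.infinite_range_of_injective hinj ((h𝒢.finite_near hΓ (x 0) 1).subset ?_)
  rintro _ ⟨k, rfl⟩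
  exact ⟨x, hx, x, hx, le_rfl, le_rfl, by rw [hpow, hx.1, neg_neg]⟩

theorem isCompact_ball_hyperboloid (n : ℕ) (R : ℝ) :
    IsCompact {x : Mink n | x ∈ hyperboloid n ∧ x 0 ≤ R} := by
  refine Metric.isCompact_of_isClosed_isBounded ?_ ?_
  · have : {x : Mink n | x ∈ hyperboloid n ∧ x 0 ≤ R} =
        {x | lorentz x x = -1} ∩ {x | 0 ≤ x 0} ∩ {x | x 0 ≤ R} := by
      ext x
      constructor
      · rintro ⟨⟨h1, h2⟩, h3⟩; exact ⟨⟨h1, h2.le⟩, h3⟩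
      · rintro ⟨⟨h1, h2⟩, h3⟩
        refine ⟨⟨h1, lt_of_le_of_ne h2 fun h0 => ?_⟩, h3⟩
        have h4 : lorentz x x = -1 := h1
        rw [lorentz_self, ← h0] at h4
        have : 0 ≤ ∑ i : Fin (2 * n + 1), x i.succ ^ 2 := Finset.sum_nonneg fun i _ => sq_nonneg _
        linarith
    rw [this]
    refine ((isClosed_eq (continuous_lorentz continuous_id continuous_id) continuous_const).inter
      (isClosed_le continuous_const (continuous_apply 0))).inter
      (isClosed_le (continuous_apply 0) continuous_const)
  · refine (Metric.isBounded_closedBall (x := (0 : Mink n)) (r := R)).subset ?_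
    rintro x ⟨hx, hR⟩
    rw [mem_closedBall_zero_iff, pi_norm_le_iff_of_nonneg (hx.2.le.trans hR)]
    exact fun i => (abs_coord_le hx i).trans hR

/-- The translation lengths of the nontrivial elements of a torsion-free cocompact discrete
subgroup are bounded away from zero. -/
theorem IsGeometric.exists_pos_le_length (h𝒢 : 𝒢.IsGeometric) (hΓ : DiscreteTopology Γ)
    (htf : ∀ γ : Γ, γ ≠ 1 → ¬IsOfFinOrder γ)
    (hco : CompactSpace (Quotient (QuotientGroup.rightRel Γ))) :
    ∃ l₀ : ℝ, 0 < l₀ ∧ ∀ γ : Γ, γ ≠ 1 → l₀ ≤ 𝒢.length γ := by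
  obtain ⟨R, hR⟩ := h𝒢.exists_radius hco
  set D := {x : Mink n | x ∈ hyperboloid n ∧ x 0 ≤ R} with hD
  have hne : D.Nonempty := by
    obtain ⟨γ, hγ⟩ := hR _ (basePt_mem n)
    exact ⟨_, h𝒢.vec_mem γ _ (basePt_mem n), hγ⟩
  -- The minimum over the compact ball is attained, and it exceeds `1` because `γ` has no fixed
  -- point.
  have hmin : ∀ γ : Γ, γ ≠ 1 → ∃ m : ℝ, 1 < m ∧ ∀ x ∈ D, m ≤ -lorentz x (𝒢.vec γ x) :=
    fun γ hγ => by
      have hc : Continuous fun x : Mink n => -lorentz x (𝒢.vec γ x) :=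
        (continuous_lorentz continuous_id
          (LinearMap.continuous_of_finiteDimensional (𝒢.vec γ))).neg
      obtain ⟨x, hx, hle⟩ := (isCompact_ball_hyperboloid n R).exists_isMinOn hne hc.continuousOn
      refine ⟨_, lt_of_le_of_ne (one_le_neg_lorentz hx.1 (h𝒢.vec_mem γ x hx.1)) fun h => ?_,
        fun y hy => hle hy⟩
      exact h𝒢.vec_ne_of_torsionFree hΓ htf hγ hx.1
        (eq_of_neg_lorentz_eq_one hx.1 (h𝒢.vec_mem γ x hx.1) h.symm).symm
  choose! m hm1 hm using hmin
  -- Every nontrivial element outside this finite set has displacement with `cosh` above `2` on all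
  -- of `D`, so finitely many minima remain.
  have hfin := (h𝒢.finite_near hΓ R 2).subset (t := {γ : Γ | γ ≠ 1 ∧ ∃ x ∈ D,
    -lorentz x (𝒢.vec γ x) ≤ 2}) (by
      rintro γ ⟨_, x, hx, h⟩; exact ⟨x, hx.1, x, hx.1, hx.2, hx.2, h⟩)
  obtain ⟨c, hc1, hc⟩ : ∃ c : ℝ, 1 < c ∧ ∀ γ : Γ, γ ≠ 1 → ∀ x ∈ D,
      c ≤ -lorentz x (𝒢.vec γ x) := by
    rcases hfin.toFinset.eq_empty_or_nonempty with he | hne'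
    · refine ⟨2, one_lt_two, fun γ hγ x hx => le_of_not_ge fun h => ?_⟩
      have : γ ∈ hfin.toFinset := hfin.mem_toFinset.2 ⟨hγ, x, hx, h⟩
      simp [he] at this
    · obtain ⟨δ, hδ, hle⟩ := hfin.toFinset.exists_min_image m hne'
      refine ⟨min 2 (m δ), lt_min one_lt_two (hm1 δ (hfin.mem_toFinset.1 hδ).1),
        fun γ hγ x hx => ?_⟩
      by_cases h : -lorentz x (𝒢.vec γ x) ≤ 2
      · exact (min_le_right _ _).trans
          ((hle γ (hfin.mem_toFinset.2 ⟨hγ, x, hx, h⟩)).trans (hm γ hγ x hx))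
      · exact (min_le_left _ _).trans (not_le.1 h).le
  refine ⟨Real.arcosh c, Real.arcosh_pos hc1, fun γ hγ => ?_⟩
  refine le_csInf (nonempty_displacement _) ?_
  rintro _ ⟨x, hx, rfl⟩
  obtain ⟨δ, hδ⟩ := hR x hx
  have h1 := hc (δ * γ * δ⁻¹) (fun h => hγ (by simpa using h)) (𝒢.vec δ x)
    ⟨h𝒢.vec_mem δ x hx, hδ⟩
  have h2 := vec_conj_apply (γ : 𝒢.G) (δ : 𝒢.G) x
  rw [Subgroup.coe_mul, Subgroup.coe_mul, Subgroup.coe_inv, h2] at h1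
  exact (Real.arcosh_le_arcosh (by linarith) (by linarith)).2 h1

theorem prod_map_range_telescope {G : Type*} [Group G] (δ : ℕ → G) (N : ℕ) :
    ((List.range N).map fun j => δ j * (δ (j + 1))⁻¹).prod = δ 0 * (δ N)⁻¹ := by
  induction N with
  | zero => simp
  | succ N ih => rw [List.range_succ, List.map_append, List.prod_append, ih]; simp [mul_assoc]

/-- A cocompact discrete subgroup has a finite set `S` such that every element `γ` is conjugate to
a product of at most `l(γ) + 2` elements of `S`. -/
theorem IsGeometric.exists_finite_words (h𝒢 : 𝒢.IsGeometric) (hΓ : DiscreteTopology Γ)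
    (hco : CompactSpace (Quotient (QuotientGroup.rightRel Γ))) :
    ∃ S : Finset Γ, ∀ γ : Γ, ∃ (δ : Γ) (w : List S), (w.map Subtype.val).prod = δ * γ * δ⁻¹ ∧
      (w.length : ℝ) ≤ 𝒢.length γ + 2 := by
  obtain ⟨R, hR⟩ := h𝒢.exists_radius hco
  have hfin := h𝒢.finite_near hΓ R (Real.cosh 1)
  refine ⟨hfin.toFinset, fun γ => ?_⟩
  obtain ⟨_, ⟨x, hx, rfl⟩, hlt⟩ := exists_lt_of_csInf_lt (nonempty_displacement (γ : 𝒢.G))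
    (show 𝒢.length γ < 𝒢.length γ + 1 by linarith)
  obtain ⟨α, hα⟩ := hR x hx
  set y := 𝒢.vec α x with hy
  have hyH : y ∈ hyperboloid n := h𝒢.vec_mem α x hx
  set β := α * γ * α⁻¹ with hβ
  have hyd : hypDist y (𝒢.vec β y) = hypDist x (𝒢.vec γ x) := by
    rw [hypDist, hypDist, hβ, Subgroup.coe_mul, Subgroup.coe_mul, Subgroup.coe_inv,
      vec_conj_apply]
  have hl0 := h𝒢.length_nonneg (γ : 𝒢.G)
  -- One unit of slack pays for approximating the infimum, the other for rounding up. Also `N ≠ 0`,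
  -- so the two endpoint cases of `δ` below do not collide.
  set N := ⌈𝒢.length γ + 1⌉₊ with hN
  have hNle : (N : ℝ) ≤ 𝒢.length γ + 2 := by
    have := Nat.ceil_lt_add_one (show 0 ≤ 𝒢.length γ + 1 by linarith)
    linarith
  have hNpos : N ≠ 0 := (Nat.ceil_pos.2 (by linarith)).ne'
  obtain ⟨z, hzH, hz0, hzN, hz⟩ := exists_chain hyH (h𝒢.vec_mem β y hyH) (N := N)
    (hyd.trans_le (hlt.le.trans (Nat.le_ceil _)))
  choose ε hε using fun j => hR (z j) (hzH j)
  -- The ends are prescribed: `1` and `β⁻¹` return `y` and `β y` to `y`, already in the ball, and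
  -- make the product telescope to `β`.
  set δ : ℕ → Γ := fun j => if j = 0 then 1 else if j = N then β⁻¹ else ε j with hδ
  have hδR : ∀ j, 𝒢.vec (δ j) (z j) 0 ≤ R := fun j => by
    simp only [hδ]
    split_ifs with h0 h1
    · subst h0; simpa [hz0] using hα
    · subst h1
      rw [hzN, Subgroup.coe_inv, ← Module.End.mul_apply, 𝒢.vec_inv_mul]
      exact hα
    · exact hε j
  have hmem : ∀ j, δ j * (δ (j + 1))⁻¹ ∈ hfin.toFinset := fun j => by
    refine hfin.mem_toFinset.2 ⟨_, h𝒢.vec_mem (δ j) _ (hzH j), _,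
      h𝒢.vec_mem (δ (j + 1)) _ (hzH (j + 1)), hδR j, hδR (j + 1), ?_⟩
    -- `δ_j δ_{j+1}⁻¹` sends `δ_{j+1} z_{j+1}` to `δ_j z_{j+1}`, which is one step away from `δ_j
    -- z_j`.
    rw [← Module.End.mul_apply, ← map_mul, Subgroup.coe_mul, Subgroup.coe_inv,
      inv_mul_cancel_right, 𝒢.lorentz_vec_vec]
    exact hz j
  refine ⟨α, (List.range N).map fun j => ⟨_, hmem j⟩, ?_, by simpa using hNle⟩
  rw [List.map_map]
  refine (prod_map_range_telescope δ N).trans ?_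
  simp [hδ, hNpos, hβ]

end LorentzModel

/-! ### Growth of powers of an endomorphism -/

section Growth

/-- All matrix coefficients of the powers `f ^ j` are `O(r ^ j)`. -/
def GrowthLE {𝕜 V : Type*} [NormedField 𝕜] [AddCommGroup V] [Module 𝕜 V] (f : Module.End 𝕜 V)
    (r : ℝ) : Prop :=
  ∀ (v : V) (φ : Module.Dual 𝕜 V), ∃ C : ℝ, ∀ j : ℕ, ‖φ ((f ^ j) v)‖ ≤ C * r ^ j

section Basic

variable {𝕜 V W : Type*} [NormedField 𝕜] [AddCommGroup V] [Module 𝕜 V] [AddCommGroup W]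
  [Module 𝕜 W]

/-- Test on an eigenvector: `‖μ‖ ^ j` cannot be `O(r ^ j)` if `‖μ‖ > r`. -/
theorem GrowthLE.norm_eigenvalue_le {f : Module.End 𝕜 V} {r : ℝ} (hf : GrowthLE f r) (hr : 0 ≤ r)
    {μ : 𝕜} (hμ : f.HasEigenvalue μ) : ‖μ‖ ≤ r := by
  obtain ⟨v, hv⟩ := hμ.exists_hasEigenvector
  obtain ⟨φ, hφ⟩ : ∃ φ : Module.Dual 𝕜 V, φ v ≠ 0 := by
    by_contra! h
    exact hv.2 ((Module.forall_dual_apply_eq_zero_iff 𝕜 v).1 h)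
  obtain ⟨C, hC⟩ := hf v φ
  have h1 : ∀ j : ℕ, ‖μ‖ ^ j * ‖φ v‖ ≤ C * r ^ j := fun j => by
    have := hC j
    rwa [hv.pow_apply, map_smul, norm_smul, norm_pow] at this
  have hpos : 0 < ‖φ v‖ := norm_pos_iff.2 hφ
  refine le_of_not_gt fun hlt => ?_
  rcases hr.eq_or_lt with h0 | h0
  · have := h1 1
    rw [← h0] at this hlt
    have h2 : 0 < ‖μ‖ ^ 1 * ‖φ v‖ := by positivity
    simp only [pow_one, mul_zero] at *
    linarith
  · obtain ⟨j, hj⟩ := pow_unbounded_of_one_lt (C / ‖φ v‖) ((one_lt_div h0).2 hlt)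
    have h2 := h1 j
    rw [div_pow, div_lt_div_iff₀ hpos (by positivity)] at hj
    linarith

theorem GrowthLE.mono {f : Module.End 𝕜 V} {r r' : ℝ} (hf : GrowthLE f r) (hr : 0 ≤ r)
    (h : r ≤ r') : GrowthLE f r' := fun v φ => by
  obtain ⟨C, hC⟩ := hf v φ
  refine ⟨C, fun j => (hC j).trans ?_⟩
  have hC0 : 0 ≤ C := by simpa using (norm_nonneg _).trans (hC 0)
  gcongr

theorem GrowthLE.smul {f : Module.End 𝕜 V} {r : ℝ} (hf : GrowthLE f r) (z : 𝕜) :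
    GrowthLE (z • f) (‖z‖ * r) := fun v φ => by
  obtain ⟨C, hC⟩ := hf v φ
  refine ⟨C, fun j => ?_⟩
  rw [smul_pow, LinearMap.smul_apply, map_smul, norm_smul, norm_pow, mul_pow]
  nlinarith [hC j, pow_nonneg (norm_nonneg z) j]

/-- Used for `S^{k+1}` as a quotient of `S^k ⊗ U`, and for invariance under conjugation. -/
theorem GrowthLE.of_surjective {f : Module.End 𝕜 V} {g : Module.End 𝕜 W} {r : ℝ}
    (hf : GrowthLE f r) (q : V →ₗ[𝕜] W) (hq : Function.Surjective q)
    (h : ∀ v, q (f v) = g (q v)) : GrowthLE g r := fun w φ => by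
  obtain ⟨v, rfl⟩ := hq w
  obtain ⟨C, hC⟩ := hf v (φ ∘ₗ q)
  have hj : ∀ j : ℕ, q ((f ^ j) v) = (g ^ j) (q v) := fun j => by
    induction j with
    | zero => simp
    | succ j ih => rw [pow_succ', pow_succ', Module.End.mul_apply, Module.End.mul_apply, h, ih]
  exact ⟨C, fun j => by simpa [hj] using hC j⟩

theorem GrowthLE.tensor [FiniteDimensional 𝕜 V] {f : Module.End 𝕜 V} {g : Module.End 𝕜 W}
    {r s : ℝ} (hf : GrowthLE f r) (hg : GrowthLE g s) :
    GrowthLE (TensorProduct.map f g : Module.End 𝕜 (V ⊗[𝕜] W)) (r * s) := fun x φ => by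
  induction x with
  | zero => exact ⟨0, fun j => by simp⟩
  | add x y hx hy =>
    obtain ⟨C, hC⟩ := hx
    obtain ⟨D, hD⟩ := hy
    refine ⟨C + D, fun j => ?_⟩
    rw [map_add, map_add, add_mul]
    exact (norm_add_le _ _).trans (add_le_add (hC j) (hD j))
  | tmul v w =>
    -- A functional on the tensor product need not be decomposable; expanding `f ^ j v` in a basis
    -- reduces it to functionals on the second factor.
    let b := Module.finBasis 𝕜 V
    choose C hC using fun i => hf v (b.coord i)
    choose D hD using fun i => hg w (φ ∘ₗ TensorProduct.mk 𝕜 V W (b i))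
    refine ⟨∑ i, C i * D i, fun j => ?_⟩
    rw [TensorProduct.map_pow, TensorProduct.map_tmul, ← b.sum_repr ((f ^ j) v),
      TensorProduct.sum_tmul, map_sum, Finset.sum_mul]
    refine (norm_sum_le _ _).trans (Finset.sum_le_sum fun i _ => ?_)
    rw [← TensorProduct.smul_tmul', map_smul, norm_smul, mul_pow]
    have h1 := hC i j
    have h2 := hD i j
    simp only [Module.Basis.coord_apply, LinearMap.comp_apply, TensorProduct.mk_apply] at h1 h2
    calc _ ≤ (C i * r ^ j) * (D i * s ^ j) :=
          mul_le_mul h1 h2 (norm_nonneg _) ((norm_nonneg _).trans h1)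
      _ = _ := by ring

end Basic

/-- The endomorphisms of a finite-dimensional space carry a submultiplicative norm. -/
theorem exists_submultiplicative_norm (V : Type*) [AddCommGroup V] [Module ℂ V]
    [FiniteDimensional ℂ V] : ∃ N : Module.End ℂ V → ℝ, (∀ f, 0 ≤ N f) ∧
      (∀ f g, N (f * g) ≤ N f * N g) ∧
      ∀ (v : V) (φ : Module.Dual ℂ V), ∃ C : ℝ, 0 ≤ C ∧ ∀ f, ‖φ (f v)‖ ≤ C * N f := by
  let e := (Module.finBasis ℂ V).equivFun
  let F : Module.End ℂ V → (Fin (Module.finrank ℂ V) → ℂ) →L[ℂ] (Fin (Module.finrank ℂ V) → ℂ) :=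
    fun f => LinearMap.toContinuousLinearMap (e.conj f)
  refine ⟨fun f => ‖F f‖, fun f => norm_nonneg _, fun f g => ?_, fun v φ => ?_⟩
  · have : F (f * g) = (F f).comp (F g) := by
      ext x; simp [F, LinearEquiv.conj_apply]
    change ‖F (f * g)‖ ≤ _
    rw [this]
    exact ContinuousLinearMap.opNorm_comp_le _ _
  · let T := LinearMap.toContinuousLinearMap (φ ∘ₗ e.symm.toLinearMap)
    refine ⟨‖T‖ * ‖e v‖, by positivity, fun f => ?_⟩
    have h : φ (f v) = T (F f (e v)) := by simp [T, F, LinearEquiv.conj_apply]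
    rw [h, mul_assoc, mul_comm ‖e v‖]
    exact (T.le_opNorm _).trans
      (mul_le_mul_of_nonneg_left ((F f).le_opNorm _) (norm_nonneg _))

theorem GrowthLE.of_norm {V : Type*} [AddCommGroup V] [Module ℂ V] {N : Module.End ℂ V → ℝ}
    (h0 : ∀ f, 0 ≤ N f) (hmul : ∀ f g, N (f * g) ≤ N f * N g)
    (hb : ∀ (v : V) (φ : Module.Dual ℂ V), ∃ C : ℝ, 0 ≤ C ∧ ∀ f, ‖φ (f v)‖ ≤ C * N f)
    (f : Module.End ℂ V) : GrowthLE f (N f) := fun v φ => by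
  obtain ⟨C, hC0, hC⟩ := hb v φ
  have hpow : ∀ j : ℕ, N (f ^ j) ≤ N 1 * N f ^ j := fun j => by
    induction j with
    | zero => simp
    | succ j ih =>
      rw [pow_succ, pow_succ, ← mul_assoc]
      exact (hmul _ _).trans (mul_le_mul_of_nonneg_right ih (h0 f))
  refine ⟨C * N 1, fun j => (hC _).trans ?_⟩
  rw [mul_assoc]
  exact mul_le_mul_of_nonneg_left (hpow j) hC0

theorem GrowthLE.of_isometry {W : Type*} [NormedAddCommGroup W] [InnerProductSpace ℂ W]
    [FiniteDimensional ℂ W] {f : Module.End ℂ W} (hf : ∀ v w, inner ℂ (f v) (f w) = inner ℂ v w) :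
    GrowthLE f 1 := fun w φ => by
  have hn : ∀ v, ‖f v‖ = ‖v‖ := fun v => by
    rw [norm_eq_sqrt_re_inner (𝕜 := ℂ), hf, ← norm_eq_sqrt_re_inner]
  have hj : ∀ j : ℕ, ‖(f ^ j) w‖ = ‖w‖ := fun j => by
    induction j with
    | zero => simp
    | succ j ih => rw [pow_succ', Module.End.mul_apply, hn, ih]
  refine ⟨‖LinearMap.toContinuousLinearMap φ‖ * ‖w‖, fun j => ?_⟩
  rw [one_pow, mul_one, ← hj j]
  exact (LinearMap.toContinuousLinearMap φ).le_opNorm _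

theorem GrowthLE.baseChange {U : Type*} [AddCommGroup U] [Module ℝ U] {f : Module.End ℝ U} {r : ℝ}
    (hf : GrowthLE f r) : GrowthLE (f.baseChange ℂ : Module.End ℂ (ℂ ⊗[ℝ] U)) r := fun x φ => by
  induction x with
  | zero => exact ⟨0, fun j => by simp⟩
  | add x y hx hy =>
    obtain ⟨C, hC⟩ := hx
    obtain ⟨D, hD⟩ := hy
    refine ⟨C + D, fun j => ?_⟩
    rw [map_add, map_add, add_mul]
    exact (norm_add_le _ _).trans (add_le_add (hC j) (hD j))
  | tmul c u =>
    let ψ : U →ₗ[ℝ] ℂ := φ.restrictScalars ℝ ∘ₗ TensorProduct.mk ℝ ℂ U c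
    obtain ⟨C, hC⟩ := hf u (Complex.reLm ∘ₗ ψ)
    obtain ⟨D, hD⟩ := hf u (Complex.imLm ∘ₗ ψ)
    refine ⟨C + D, fun j => ?_⟩
    have hpow : ((f.baseChange ℂ) ^ j) (c ⊗ₜ[ℝ] u) = c ⊗ₜ[ℝ] (f ^ j) u := by
      induction j with
      | zero => simp
      | succ j ih => rw [pow_succ', pow_succ', Module.End.mul_apply, ih]; simp
    rw [hpow, add_mul]
    exact (Complex.norm_le_abs_re_add_abs_im _).trans (add_le_add (hC j) (hD j))

/-! ### Symmetric powers -/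

section SymPow

variable {U : Type*} [AddCommGroup U] [Module ℂ U]

theorem symPow_succ (k : ℕ) :
    symPow ℂ U (k + 1) = symPow ℂ U k * LinearMap.range (SymmetricAlgebra.ι ℂ U) :=
  pow_succ _ _

/-- Multiplication `S^k(U) ⊗ U → S^{k+1}(U)`. -/
def symPowMul (U : Type*) [AddCommGroup U] [Module ℂ U] (k : ℕ) :
    symPow ℂ U k ⊗[ℂ] U →ₗ[ℂ] symPow ℂ U (k + 1) :=
  TensorProduct.lift (LinearMap.mk₂ ℂ
    (fun x u => ⟨x.1 * SymmetricAlgebra.ι ℂ U u, by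
      rw [symPow_succ]; exact Submodule.mul_mem_mul x.2 ⟨u, rfl⟩⟩)
    (fun x y u => Subtype.ext (by simp [add_mul]))
    (fun c x u => Subtype.ext (by simp))
    (fun x u v => Subtype.ext (by simp [mul_add]))
    (fun c x u => Subtype.ext (by simp)))

theorem symPowMul_tmul (k : ℕ) (x : symPow ℂ U k) (u : U) :
    (symPowMul U k (x ⊗ₜ u) : SymmetricAlgebra ℂ U) = x * SymmetricAlgebra.ι ℂ U u := rfl

theorem symPowMul_surjective (k : ℕ) : Function.Surjective (symPowMul U k) := by
  rintro ⟨y, hy⟩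
  suffices h : ∃ t, (symPowMul U k t : SymmetricAlgebra ℂ U) = y from
    h.imp fun t ht => Subtype.ext ht
  rw [symPow_succ] at hy
  induction hy using Submodule.mul_induction_on' with
  | mem_mul_mem x hx u hu =>
    obtain ⟨u, rfl⟩ := hu
    exact ⟨⟨x, hx⟩ ⊗ₜ u, rfl⟩
  | add x _ y _ hx hy =>
    obtain ⟨s, hs⟩ := hx
    obtain ⟨t, ht⟩ := hy
    exact ⟨s + t, by rw [map_add, Submodule.coe_add, hs, ht]⟩

theorem symPowMul_map (f : U →ₗ[ℂ] U) (k : ℕ) (t : symPow ℂ U k ⊗[ℂ] U) :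
    symPowMul U k (TensorProduct.map (symPowMap f k) f t) =
      symPowMap f (k + 1) (symPowMul U k t) := by
  induction t with
  | zero => simp
  | add x y hx hy => simp only [map_add, hx, hy]
  | tmul x u =>
    refine Subtype.ext ?_
    rw [TensorProduct.map_tmul, symPowMul_tmul]
    change symAlgMap f x.1 * _ = symAlgMap f (x.1 * _)
    rw [map_mul]
    congr 1
    simp [symAlgMap]

instance [FiniteDimensional ℂ U] (k : ℕ) : FiniteDimensional ℂ (symPow ℂ U k) := by
  refine Module.Finite.iff_fg.2 ?_
  refine Submodule.FG.pow ?_ k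
  rw [LinearMap.range_eq_map]
  exact Module.Finite.fg_top.map _

theorem GrowthLE.symPowMap [FiniteDimensional ℂ U] {f : Module.End ℂ U} {r : ℝ} (hf : GrowthLE f r) (k : ℕ) :
    GrowthLE (HypZeta.symPowMap f k : Module.End ℂ (symPow ℂ U k)) (r ^ k) := by
  induction k with
  | zero =>
    have h1 : (HypZeta.symPowMap f 0 : Module.End ℂ (symPow ℂ U 0)) = 1 := by
      refine LinearMap.ext fun x => Subtype.ext ?_
      obtain ⟨x, hx⟩ := x
      rw [symPow, pow_zero, Submodule.mem_one] at hx
      obtain ⟨c, rfl⟩ := hx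
      exact (symAlgMap f).commutes c
    rw [h1]
    exact fun v φ => ⟨‖φ v‖, fun j => by simp⟩
  | succ k ih =>
    rw [pow_succ]
    exact (ih.tensor hf).of_surjective (symPowMul U k) (symPowMul_surjective k) (symPowMul_map f k)

/-- The dimension of `S^k(U)` grows at most polynomially. -/
theorem finrank_symPow_le [FiniteDimensional ℂ U] (k : ℕ) :
    Module.finrank ℂ (symPow ℂ U k) ≤ (k + 1) ^ Module.finrank ℂ U := by
  classical
  let b := Module.finBasis ℂ U
  -- All monomials with every exponent at most `k`, an overcount of those of degree `k` that is easy
  -- to enumerate.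
  let F : (Fin (Module.finrank ℂ U) → Fin (k + 1)) → SymmetricAlgebra ℂ U :=
    fun m => ∏ i, SymmetricAlgebra.ι ℂ U (b i) ^ (m i : ℕ)
  have hle : symPow ℂ U k ≤ Submodule.span ℂ (Set.range F) := by
    have hr : LinearMap.range (SymmetricAlgebra.ι ℂ U) =
        Submodule.span ℂ (Set.range fun i => SymmetricAlgebra.ι ℂ U (b i)) := by
      rw [LinearMap.range_eq_map, ← b.span_eq, Submodule.map_span, ← Set.range_comp]; rfl
    rw [symPow, hr, Submodule.span_pow]
    refine Submodule.span_mono fun x hx => ?_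
    obtain ⟨p, rfl⟩ := Set.mem_pow.1 hx
    choose c hc using fun j => (p j).2
    have hprod : (List.ofFn fun j => (p j : SymmetricAlgebra ℂ U)).prod =
        ∏ i, SymmetricAlgebra.ι ℂ U (b i) ^ (Finset.univ.filter fun j => c j = i).card := by
      rw [List.prod_ofFn, ← Finset.prod_fiberwise Finset.univ c]
      refine Finset.prod_congr rfl fun i _ => ?_
      rw [← Finset.prod_const]
      refine Finset.prod_congr rfl fun j hj => ?_
      rw [← (Finset.mem_filter.1 hj).2, ← hc j]
    rw [hprod]
    refine ⟨fun i => ⟨(Finset.univ.filter fun j => c j = i).card, ?_⟩, rfl⟩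
    exact Nat.lt_succ_of_le ((Finset.card_le_univ _).trans (by simp))
  have : FiniteDimensional ℂ (Submodule.span ℂ (Set.range F)) :=
    FiniteDimensional.span_of_finite ℂ (Set.finite_range F)
  refine (Submodule.finrank_mono hle).trans ((finrank_range_le_card F).trans ?_)
  simp

end SymPow

/-! ### Determinants -/

theorem norm_multiset_prod_sub_one_le {r : ℝ} (s : Multiset ℂ)
    (h : ∀ μ ∈ s, ‖μ - 1‖ ≤ r) : ‖s.prod - 1‖ ≤ (1 + r) ^ s.card - 1 := by
  induction s using Multiset.induction_on with
  | empty => simp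
  | cons a s ih =>
    have ha := h a (Multiset.mem_cons_self a s)
    have hs := ih fun μ hμ => h μ (Multiset.mem_cons_of_mem hμ)
    have hr : 0 ≤ r := (norm_nonneg _).trans ha
    rw [Multiset.prod_cons, Multiset.card_cons, pow_succ]
    have h1 : a * s.prod - 1 = (a - 1) + (s.prod - 1) + (a - 1) * (s.prod - 1) := by ring
    rw [h1]
    refine (norm_add₃_le).trans ?_
    rw [norm_mul]
    have := mul_le_mul ha hs (norm_nonneg _) hr
    linarith

/-- The determinant is the product of the eigenvalues of `1 - A`, each within `r` of `1`. -/
theorem GrowthLE.norm_det_sub_one_le {V : Type*} [AddCommGroup V] [Module ℂ V]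
    [FiniteDimensional ℂ V] {A : Module.End ℂ V} {r : ℝ} (hA : GrowthLE A r) (hr : 0 ≤ r) :
    ‖LinearMap.det (1 - A) - 1‖ ≤ (1 + r) ^ Module.finrank ℂ V - 1 := by
  have hsp := IsAlgClosed.splits (LinearMap.charpoly (1 - A))
  rw [Module.End.det_eq_prod_roots_charpoly_of_splits hsp]
  have hcard : (LinearMap.charpoly (1 - A)).roots.card = Module.finrank ℂ V := by
    rw [← hsp.natDegree_eq_card_roots, LinearMap.charpoly_natDegree]
  rw [← hcard]
  refine norm_multiset_prod_sub_one_le _ fun μ hμ => ?_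
  have hev := (Module.End.hasEigenvalue_iff_isRoot_charpoly (1 - A) μ).2
    (Polynomial.isRoot_of_mem_roots hμ)
  obtain ⟨v, hv⟩ := hev.exists_hasEigenvector
  rw [norm_sub_rev]
  refine hA.norm_eigenvalue_le hr (Module.End.hasEigenvalue_of_hasEigenvector (x := v)
    (Module.End.hasEigenvector_iff.2 ⟨Module.End.mem_eigenspace_iff.2 ?_, hv.2⟩))
  have := hv.apply_eq_smul
  rw [LinearMap.sub_apply, Module.End.one_apply] at this
  rw [sub_smul, one_smul, ← this, sub_sub_cancel]

end Growth

/-! ### The adjoint action on `𝔫̄` -/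

section Adjoint

variable {n : ℕ}

theorem genH_mul_of_mem_nbar {X : Module.End ℝ (Mink n)} (hX : X ∈ nbar n) :
    genH n * X = X * genH n - X := by
  have h : genH n * X - X * genH n = (-1 : ℝ) • X := hX.2
  rw [sub_eq_iff_eq_add.1 h]; module

/-- From `H X = X (H - 1)` follows `p(H) X = X p(H - 1)` for polynomials `p`; take `p(H) = H³ - H =
0`. -/
theorem mul_genH_sq_of_mem_nbar {X : Module.End ℝ (Mink n)} (hX : X ∈ nbar n) :
    X * (genH n * genH n) = X * genH n := by
  have h := genH_mul_of_mem_nbar hX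
  set H := genH n
  have h3 : H * H * H = H := genH_cube n
  have e2 : H * (H * X) = X * (H * H) - (2 : ℝ) • (X * H) + X := by
    rw [h, mul_sub, ← mul_assoc, h, sub_mul, mul_assoc]; module
  have e3 : H * (H * (H * X)) = X * (H * H * H) - (3 : ℝ) • (X * (H * H)) + (3 : ℝ) • (X * H) - X := by
    rw [e2, mul_add, mul_sub, mul_smul_comm, ← mul_assoc H X, ← mul_assoc H X, h, sub_mul, sub_mul,
      mul_assoc X H H, mul_assoc X H (H * H), ← mul_assoc H H H]
    module
  have e4 : H * (H * (H * X)) = H * X := by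
    rw [← mul_assoc, ← mul_assoc, h3]
  rw [e4, h3, h] at e3
  have e5 : (3 : ℝ) • (X * (H * H)) = (3 : ℝ) • (X * H) := by
    rw [← sub_eq_zero, ← sub_eq_zero.2 e3]; module
  exact smul_right_injective _ (three_ne_zero' ℝ) e5

/-- This is `e^{tH} X = X e^{t(H - 1)}`, checked on the closed form of the boost. -/
theorem boostMap_mul_of_mem_nbar {X : Module.End ℝ (Mink n)} (hX : X ∈ nbar n) (t : ℝ) :
    boostMap n t * X = Real.exp (-t) • (X * boostMap n t) := by
  have h := genH_mul_of_mem_nbar hX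
  have h2 := mul_genH_sq_of_mem_nbar hX
  have e2 : genH n * genH n * X = X - X * genH n := by
    rw [mul_assoc, h, mul_sub, ← mul_assoc, h, sub_mul, mul_assoc, h2]; abel
  rw [boostMap, add_mul, add_mul, one_mul, smul_mul_assoc, smul_mul_assoc, h, e2, mul_add, mul_add,
    mul_one, mul_smul_comm, mul_smul_comm, h2, Real.exp_neg, ← Real.cosh_add_sinh,
    inv_eq_of_mul_eq_one_right (b := Real.cosh t - Real.sinh t)
      (by linear_combination Real.cosh_sq_sub_sinh_sq t)]
  have hc := Real.cosh_sq_sub_sinh_sq t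
  have e3 : (Real.cosh t - Real.sinh t) • (Real.sinh t • (X * genH n)) +
      (Real.cosh t - Real.sinh t) • ((Real.cosh t - 1) • (X * genH n)) =
      (1 - Real.cosh t + Real.sinh t) • (X * genH n) := by
    rw [smul_smul, smul_smul, ← add_smul]
    congr 1
    linear_combination hc
  rw [smul_add, smul_add, add_assoc (_ • X), e3]
  module

namespace LorentzModel

variable (𝒢 : LorentzModel n)

theorem Ad_of_mem_nbar (m : 𝒢.G) (t : ℝ) {X : Module.End ℝ (Mink n)} (hX : X ∈ nbar n) :
    𝒢.Ad (m * 𝒢.expH t) X = Real.exp (-t) • (𝒢.vec m * X * 𝒢.vec m⁻¹) := by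
  have h1 := 𝒢.vec_mul_inv (𝒢.expH t)
  rw [𝒢.vec_expH] at h1
  change 𝒢.vec (m * 𝒢.expH t) * X * 𝒢.vec (m * 𝒢.expH t)⁻¹ = _
  rw [mul_inv_rev, map_mul, map_mul, 𝒢.vec_expH, mul_assoc _ _ X, boostMap_mul_of_mem_nbar hX,
    mul_smul_comm, smul_mul_assoc]
  simp only [mul_assoc]
  rw [← mul_assoc (boostMap n t), h1, one_mul]

theorem coe_adNbar_pow (m : 𝒢.M) (t : ℝ) (j : ℕ) (X : nbar n) :
    (((𝒢.adNbar m t) ^ j) X : Module.End ℝ (Mink n)) =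
      Real.exp (-t) ^ j • (𝒢.vec ((m ^ j : 𝒢.M) : 𝒢.G) * X * 𝒢.vec ((m ^ j : 𝒢.M) : 𝒢.G)⁻¹) := by
  induction j with
  | zero => simp
  | succ j ih =>
    rw [pow_succ', Module.End.mul_apply]
    change 𝒢.Ad (m * 𝒢.expH t) (((𝒢.adNbar m t) ^ j) X : Module.End ℝ (Mink n)) = _
    rw [𝒢.Ad_of_mem_nbar _ _ (((𝒢.adNbar m t) ^ j) X).2, ih, mul_smul_comm, smul_mul_assoc, smul_smul,
      ← pow_succ', pow_succ' m, Subgroup.coe_mul, mul_inv_rev, map_mul, map_mul]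
    simp only [mul_assoc]

/-- `Ad (m a)` acts on `𝔫̄` by `α(log a)⁻¹`-contracting isometries. -/
theorem IsGeometric.growthLE_adNbar {𝒢 : LorentzModel n} (h𝒢 : 𝒢.IsGeometric) (m : 𝒢.M) (t : ℝ) :
    GrowthLE (𝕜 := ℝ) (V := nbar n) (𝒢.adNbar m t) (Real.exp (-t)) := fun X φ => by
  obtain ⟨ψ, hψ⟩ := φ.exists_extend
  let T : Matrix (Fin (2 * n + 2)) (Fin (2 * n + 2)) ℝ →ₗ[ℝ] ℝ := ψ ∘ₗ Matrix.toLin'.toLinearMap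
  -- Elements of `M` fix `e₀`, so the general entry bound applies with `R = 1`, uniformly over the
  -- powers of `m`.
  have hent : ∀ m : 𝒢.M, ∀ a b, |LinearMap.toMatrix' (𝒢.vec m) a b| ≤ 2 := fun m a b => by
    rw [LinearMap.toMatrix'_apply]
    have h1 : 𝒢.vec (m : 𝒢.G) (basePt n) = basePt n := m.2.1
    have := 𝒢.abs_vec_single_le h𝒢.vec_mem (g := (m : 𝒢.G)) (R := 1) (by rw [h1]; simp [basePt]) a b
    simpa using this
  set Y := LinearMap.toMatrix' (X : Module.End ℝ (Mink n)) with hY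
  set B : ℝ := ∑ d, ∑ c, 4 * |Y d c| with hB
  have hconj : ∀ m : 𝒢.M, ∀ a b, |LinearMap.toMatrix'
      (𝒢.vec m * (X : Module.End ℝ (Mink n)) * 𝒢.vec (m : 𝒢.G)⁻¹) a b| ≤ B := fun m a b => by
    have hm' := hent m⁻¹
    rw [Subgroup.coe_inv] at hm'
    rw [LinearMap.toMatrix'_mul, LinearMap.toMatrix'_mul, Matrix.mul_apply, ← hY, hB,
      Finset.sum_comm]
    refine (Finset.abs_sum_le_sum_abs _ _).trans (Finset.sum_le_sum fun c _ => ?_)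
    rw [Matrix.mul_apply, Finset.sum_mul]
    refine (Finset.abs_sum_le_sum_abs _ _).trans (Finset.sum_le_sum fun d _ => ?_)
    rw [abs_mul, abs_mul]
    calc _ ≤ 2 * |Y d c| * 2 := by
          gcongr
          · exact hent m a d
          · exact hm' c b
      _ = _ := by ring
  refine ⟨∑ a, ∑ b, B * |T (Matrix.single a b 1)|, fun j => ?_⟩
  have h1 : φ (((𝒢.adNbar m t) ^ j) X) = Real.exp (-t) ^ j * T (LinearMap.toMatrix'
      (𝒢.vec (m ^ j : 𝒢.M) * (X : Module.End ℝ (Mink n)) * 𝒢.vec ((m ^ j : 𝒢.M) : 𝒢.G)⁻¹)) := by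
    rw [← hψ, LinearMap.comp_apply, Submodule.subtype_apply, coe_adNbar_pow, map_smul, smul_eq_mul]
    simp [T]
  have h2 : ∀ A, T A = ∑ a, ∑ b, A a b * T (Matrix.single a b 1) := fun A => by
    conv_lhs => rw [Matrix.matrix_eq_sum_single A]
    simp only [map_sum]
    refine Finset.sum_congr rfl fun a _ => Finset.sum_congr rfl fun b _ => ?_
    have h := map_smul T (A a b) (Matrix.single a b 1)
    rw [Matrix.smul_single, smul_eq_mul, mul_one] at h
    exact h
  rw [h1, h2, norm_mul, norm_pow, Real.norm_of_nonneg (Real.exp_pos _).le, mul_comm]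
  refine mul_le_mul_of_nonneg_right ?_ (by positivity)
  refine (norm_sum_le _ _).trans (Finset.sum_le_sum fun a _ => ?_)
  refine (norm_sum_le _ _).trans (Finset.sum_le_sum fun b _ => ?_)
  rw [norm_mul, Real.norm_eq_abs, Real.norm_eq_abs]
  exact mul_le_mul_of_nonneg_right (hconj _ a b) (abs_nonneg _)

end LorentzModel

end Adjoint

/-! ### Summability over words and uniformly convergent products -/

/-- There are `|S| ^ k` words of length `k`, which leaves a geometric series. -/
theorem summable_pow_length (S : Type*) [Fintype S] {q : ℝ} (hq : 0 ≤ q)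
    (h : Fintype.card S * q < 1) : Summable fun w : List S => q ^ w.length := by
  rw [← List.equivSigmaTuple.symm.summable_iff]
  have hlen : ∀ x : Σ k, (Fin k → S), (List.equivSigmaTuple.symm x).length = x.1 := fun x => by
    simp [List.equivSigmaTuple]
  simp only [Function.comp_def, hlen]
  rw [summable_sigma_of_nonneg fun x => by positivity]
  refine ⟨fun k => Summable.of_finite, ?_⟩
  simp only [tsum_fintype, Finset.sum_const, Finset.card_univ, Fintype.card_fun, Fintype.card_fin,
    nsmul_eq_mul, Nat.cast_pow, ← mul_pow]
  exact summable_geometric_of_lt_one (by positivity) h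

theorem exp_sub_one_le_mul_exp (u : ℝ) : Real.exp u - 1 ≤ u * Real.exp u := by
  have h := Real.add_one_le_exp (-u)
  have h2 := Real.exp_pos u
  have h3 : Real.exp (-u) * Real.exp u = 1 := by rw [← Real.exp_add]; simp
  nlinarith

theorem hasProdUniformlyOn_of_norm_sub_one_le {η : Type*} {G : η → ℂ → ℂ} {b : η → ℝ} {D : Set ℂ}
    (hD : IsCompact D) (hb : Summable b) (hG : ∀ p, ContinuousOn (G p) D)
    (hbd : ∀ p, ∀ s ∈ D, ‖G p s - 1‖ ≤ b p) :
    HasProdUniformlyOn G (fun s => ∏' p, G p s) D := by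
  have := hb.hasProdUniformlyOn_one_add (f := fun p s => G p s - 1) hD
    (Filter.Eventually.of_forall hbd) fun p => (hG p).sub continuousOn_const
  simpa only [add_sub_cancel] using this

/-- A double product of factors `1 + O(a)` with `a` summable converges absolutely and uniformly,
and it may be computed as an iterated product. -/
theorem uniform_double_product {ι κ : Type*} (F : ι × κ → ℂ → ℂ) {a : ι × κ → ℝ}
    (ha : Summable a) {D : Set ℂ} (hD : IsCompact D) (hc : ∀ p, ContinuousOn (F p) D)
    (hF : ∀ p, ∀ s ∈ D, ‖F p s - 1‖ ≤ a p) :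
    SummableUniformlyOn (fun p s => ‖F p s - 1‖) D ∧
    HasProdUniformlyOn F (fun s => ∏' i, ∏' k, F (i, k) s) D ∧
    (∀ i, HasProdUniformlyOn (fun k s => F (i, k) s) (fun s => ∏' k, F (i, k) s) D) ∧
    HasProdUniformlyOn (fun i s => ∏' k, F (i, k) s) (fun s => ∏' i, ∏' k, F (i, k) s) D := by
  -- Nonnegativity of `a` is read off from the bound at a point of `D`, so the empty set is
  -- separate.
  rcases D.eq_empty_or_nonempty with rfl | ⟨s₀, hs₀⟩
  · simp only [hasProdUniformlyOn_iff_tendstoUniformlyOn, tendstoUniformlyOn_empty, implies_true,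
      and_self, and_true]
    exact (hasSumUniformlyOn_iff_tendstoUniformlyOn (g := 0).2
      tendstoUniformlyOn_empty).summableUniformlyOn
  have ha0 : ∀ p, 0 ≤ a p := fun p => (norm_nonneg _).trans (hF p s₀ hs₀)
  have hinner : ∀ i, HasProdUniformlyOn (fun k s => F (i, k) s) (fun s => ∏' k, F (i, k) s) D :=
    fun i => hasProdUniformlyOn_of_norm_sub_one_le hD (ha.prod_factor i) (fun k => hc _)
      fun k s hs => hF _ s hs
  have hpairs := hasProdUniformlyOn_of_norm_sub_one_le hD ha hc hF
  refine ⟨?_, ?_, hinner, ?_⟩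
  · refine (hasSumUniformlyOn_iff_tendstoUniformlyOn.2
      (tendstoUniformlyOn_tsum ha fun p s hs => ?_)).summableUniformlyOn
    rw [norm_norm]; exact hF p s hs
  · refine hpairs.congr_right fun s hs => ?_
    exact ((hpairs.hasProd hs).prod_fiberwise fun i => (hinner i).hasProd hs).tprod_eq.symm
  · have hfib : ∀ i, Summable fun k => a (i, k) := fun i => ha.prod_factor i
    refine hasProdUniformlyOn_of_norm_sub_one_le hD
      -- An inner product differs from `1` by at most `e^u - 1 ≤ u e^u`, where `u` is the inner sum
      -- of `a`, itself at most the total sum.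
      (b := fun i => (∑' k, a (i, k)) * Real.exp (∑' p, a p)) (ha.prod.mul_right _)
      (fun i => ?_) fun i s hs => ?_
    · refine (hinner i).tendstoUniformlyOn.continuousOn (Filter.Frequently.of_forall fun t => ?_)
      exact continuousOn_finsetProd _ fun k _ => hc _
    · have hlim := ((hinner i).hasProd hs).sub_const (1 : ℂ) |>.norm
      refine le_of_tendsto hlim (Filter.Eventually.of_forall fun t => ?_)
      have h1 := t.norm_prod_one_add_sub_one_le fun k => F (i, k) s - 1
      simp only [add_sub_cancel] at h1
      have h2 : ∑ k ∈ t, ‖F (i, k) s - 1‖ ≤ ∑' k, a (i, k) :=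
        (Finset.sum_le_sum fun k _ => hF (i, k) s hs).trans
          ((hfib i).sum_le_tsum t fun k _ => ha0 _)
      have h3 : ∑' k, a (i, k) ≤ ∑' p, a p := by
        rw [ha.tsum_prod]
        exact ha.prod.le_tsum i fun j _ => tsum_nonneg fun k => ha0 _
      calc _ ≤ Real.exp (∑ k ∈ t, ‖F (i, k) s - 1‖) - 1 := h1
        _ ≤ Real.exp (∑' k, a (i, k)) - 1 := by gcongr
        _ ≤ (∑' k, a (i, k)) * Real.exp (∑' k, a (i, k)) := exp_sub_one_le_mul_exp _
        _ ≤ _ := by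
          gcongr
          exact tsum_nonneg fun k => ha0 _

/-! ### Estimates for the local factors -/

section Factor

theorem GrowthLE.of_conj {Γ V : Type*} [Group Γ] [AddCommGroup V] [Module ℂ V]
    (χ : Representation ℂ Γ V) {γ δ : Γ} {r : ℝ} (h : GrowthLE (χ (δ * γ * δ⁻¹)) r) :
    GrowthLE (χ γ) r := by
  refine h.of_surjective (χ δ⁻¹) (fun v => ⟨χ δ v, ?_⟩) fun v => ?_
  · rw [← Module.End.mul_apply, ← map_mul, inv_mul_cancel, map_one, Module.End.one_apply]
  · rw [← Module.End.mul_apply, ← Module.End.mul_apply, ← map_mul, ← map_mul]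
    congr 2
    group

/-- A finite-dimensional representation grows at most exponentially in the word length. -/
theorem exists_growthLE_word {Γ V : Type*} [Group Γ] [AddCommGroup V] [Module ℂ V]
    [FiniteDimensional ℂ V] (χ : Representation ℂ Γ V) (S : Finset Γ) :
    ∃ K C : ℝ, 0 ≤ K ∧ 1 ≤ C ∧ ∀ w : List S,
      GrowthLE (χ (w.map Subtype.val).prod) (K * C ^ w.length) := by
  obtain ⟨N, h0, hmul, hb⟩ := exists_submultiplicative_norm V
  set C : ℝ := 1 + ∑ s ∈ S, N (χ s) with hC
  have hCs : ∀ s ∈ S, N (χ s) ≤ C := fun s hs =>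
    (Finset.single_le_sum (f := fun s => N (χ s)) (fun s _ => h0 _) hs).trans (by
      rw [hC]; linarith)
  have hC1 : 1 ≤ C := by
    have : 0 ≤ ∑ s ∈ S, N (χ s) := Finset.sum_nonneg fun s _ => h0 _
    rw [hC]; linarith
  refine ⟨N 1, C, h0 1, hC1, fun w => (GrowthLE.of_norm h0 hmul hb _).mono (h0 _) ?_⟩
  induction w with
  | nil => simp
  | cons s w ih =>
    rw [List.map_cons, List.prod_cons, map_mul, List.length_cons, pow_succ]
    calc _ ≤ N (χ s) * N (χ (w.map Subtype.val).prod) := hmul _ _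
      _ ≤ C * (N 1 * C ^ w.length) :=
        mul_le_mul (hCs s s.2) ih (h0 _) (zero_le_one.trans hC1)
      _ = _ := by ring

theorem continuous_det_one_sub_smul {E : Type*} [AddCommGroup E] [Module ℂ E]
    [FiniteDimensional ℂ E] {g : ℂ → ℂ} (hg : Continuous g) (f : Module.End ℂ E) :
    Continuous fun s => LinearMap.det (1 - g s • f) := by
  let b := Module.finBasis ℂ E
  have h : ∀ s, LinearMap.det (1 - g s • f) = (1 - g s • LinearMap.toMatrix b b f).det :=
    fun s => by rw [← LinearMap.det_toMatrix b, map_sub, map_smul, LinearMap.toMatrix_one]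
  simp only [h]
  exact Continuous.matrix_det (by fun_prop)

namespace LorentzModel

variable {n : ℕ} {𝒢 : LorentzModel n} {Γ : Subgroup 𝒢.G}
  {V : Type*} [AddCommGroup V] [Module ℂ V] [FiniteDimensional ℂ V]

theorem IsGeometric.growthLE_twistedOp (h𝒢 : 𝒢.IsGeometric) {W : Type*} [NormedAddCommGroup W]
    [InnerProductSpace ℂ W] [FiniteDimensional ℂ W] {χ : Representation ℂ Γ V}
    {σ : Representation ℂ 𝒢.M W} (hσ : IsUnitaryIrrep σ) {γ : Γ} {r : ℝ} (hr : 0 ≤ r)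
    (hχ : GrowthLE (χ γ) r) (k : ℕ) :
    GrowthLE (𝒢.twistedOp χ σ γ k) (r * Real.exp (-(𝒢.length γ)) ^ k) := by
  have h1 := ((h𝒢.growthLE_adNbar (𝒢.maPart γ).1 (𝒢.maPart γ).2).baseChange).symPowMap k
  have h2 := (hχ.tensor (GrowthLE.of_isometry (hσ.unitary (𝒢.maPart γ).1))).tensor h1
  refine GrowthLE.mono h2 (by positivity) ?_
  rw [mul_one]
  have := h𝒢.length_le_maPart γ
  gcongr

/-- The determinant bound `(1 + E r) ^ dim - 1` is relaxed to an exponential, where the dimension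
enters linearly and may be replaced by its polynomial bound in `k`. -/
theorem norm_selbergFactor_sub_one_le {W : Type*} [AddCommGroup W] [Module ℂ W]
    [FiniteDimensional ℂ W] {χ : Representation ℂ Γ V} {σ : Representation ℂ 𝒢.M W} {γ : Γ} {k : ℕ}
    {r : ℝ} (hr : 0 ≤ r) (h : GrowthLE (𝒢.twistedOp χ σ γ k) r) {s : ℂ} {E : ℝ}
    (hE : ‖Complex.exp (-(s + rhoNorm n) * 𝒢.length γ)‖ ≤ E) :
    ‖𝒢.selbergFactor χ σ γ k s - 1‖ ≤ Real.exp (Module.finrank ℂ V * Module.finrank ℂ W *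
      (k + 1) ^ Module.finrank ℂ (ℂ ⊗[ℝ] nbar n) * (E * r)) - 1 := by
  have hE0 : 0 ≤ E := (norm_nonneg _).trans hE
  have h1 := (h.smul (Complex.exp (-(s + rhoNorm n) * 𝒢.length γ))).norm_det_sub_one_le
    (by positivity)
  refine h1.trans (sub_le_sub_right ?_ _)
  have h2 : 1 + ‖Complex.exp (-(s + rhoNorm n) * 𝒢.length γ)‖ * r ≤ Real.exp (E * r) := by
    refine le_trans ?_ (Real.add_one_le_exp _)
    rw [add_comm]
    gcongr
  refine (pow_le_pow_left₀ (by positivity) h2 _).trans ?_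
  rw [← Real.exp_nat_mul, Real.exp_le_exp]
  refine mul_le_mul_of_nonneg_right ?_ (by positivity)
  rw [Module.finrank_tensorProduct, Module.finrank_tensorProduct]
  push_cast
  refine mul_le_mul_of_nonneg_left ?_ (by positivity)
  exact_mod_cast finrank_symPow_le k

theorem continuous_selbergFactor {W : Type*} [AddCommGroup W] [Module ℂ W]
    [FiniteDimensional ℂ W] (χ : Representation ℂ Γ V) (σ : Representation ℂ 𝒢.M W) (γ : Γ)
    (k : ℕ) : Continuous (𝒢.selbergFactor χ σ γ k) :=
  continuous_det_one_sub_smul (by fun_prop) _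

theorem rep_ne_one (C : PrimeClass Γ) : C.rep ≠ 1 := fun h =>
  C.2.1 ((Quotient.out_eq C.1).symm.trans (congrArg ConjClasses.mk h))

theorem rhoNorm_nonneg (n : ℕ) : 0 ≤ rhoNorm n := by unfold rhoNorm; positivity

/-- The shift by `|ρ| ≥ 0` only improves the decay and is dropped. -/
theorem norm_exp_le {n : ℕ} {s : ℂ} {c l : ℝ} (hl : 0 ≤ l) (hs : c ≤ s.re) :
    ‖Complex.exp (-(s + rhoNorm n) * l)‖ ≤ Real.exp (-(c * l)) := by
  rw [Complex.norm_exp, Real.exp_le_exp]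
  have := rhoNorm_nonneg n
  simp
  nlinarith [mul_nonneg this hl]

end LorentzModel

end Factor

end HypZeta

end
-- Convergence of the zeta product
open HypZeta in
theorem proposition3p4
    (n : ℕ) (hn : 1 ≤ n)
    -- `G` is `SO⁰(d,1)` or `Spin(d,1)`, where `d = 2n+1`
    (𝒢 : LorentzModel n) (h𝒢 : 𝒢 = soModel n ∨ 𝒢 = spinModel n)
    -- `Γ` is a discrete torsion-free cocompact subgroup of `G`
    (Γ : Subgroup 𝒢.G) (hΓ_disc : DiscreteTopology Γ)
    (hΓ_tf : ∀ γ : Γ, γ ≠ 1 → ¬IsOfFinOrder γ)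
    (hΓ_cocomp : CompactSpace (Quotient (QuotientGroup.rightRel Γ)))
    -- `χ` is a finite-dimensional representation of `Γ`
    {V : Type*} [AddCommGroup V] [Module ℂ V] [FiniteDimensional ℂ V]
    (χ : Representation ℂ Γ V)
    -- `σ` is a unitary irreducible representation of the compact group `M`
    {W : Type*} [NormedAddCommGroup W] [InnerProductSpace ℂ W] [FiniteDimensional ℂ W]
    (σ : Representation ℂ 𝒢.M W) (hσ : IsUnitaryIrrep σ) :
    ∃ c : ℝ, 0 < c ∧ ∀ D : Set ℂ, IsCompact D → D ⊆ {s : ℂ | c < s.re} →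
      -- absolute convergence of the product over all pairs `([γ], k)`, uniformly on `D`
      SummableUniformlyOn
        (fun (p : PrimeClass Γ × ℕ) (s : ℂ) => ‖𝒢.selbergFactor χ σ p.1.rep p.2 s - 1‖) D ∧
      -- uniform convergence of the product over all pairs to `Z(s;σ,χ)`
      HasProdUniformlyOn
        (fun (p : PrimeClass Γ × ℕ) (s : ℂ) => 𝒢.selbergFactor χ σ p.1.rep p.2 s)
        (fun s => 𝒢.selbergZeta χ σ s) D ∧
      -- uniform convergence of the inner products and of the outer product
      (∀ C : PrimeClass Γ,
        HasProdUniformlyOn (fun (k : ℕ) (s : ℂ) => 𝒢.selbergFactor χ σ C.rep k s)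
          (fun s => ∏' k : ℕ, 𝒢.selbergFactor χ σ C.rep k s) D) ∧
      HasProdUniformlyOn
        (fun (C : PrimeClass Γ) (s : ℂ) => ∏' k : ℕ, 𝒢.selbergFactor χ σ C.rep k s)
        (fun s => 𝒢.selbergZeta χ σ s) D := by
  have hgeo : 𝒢.IsGeometric := by
    rcases h𝒢 with rfl | rfl
    · exact soModel_isGeometric n
    · exact spinModel_isGeometric n
  obtain ⟨l₀, hl₀, hlen⟩ := hgeo.exists_pos_le_length hΓ_disc hΓ_tf hΓ_cocomp
  obtain ⟨S, hS⟩ := hgeo.exists_finite_words hΓ_disc hΓ_cocomp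
  obtain ⟨K, B, hK, hB, hword⟩ := exists_growthLE_word χ S
  choose δ w hw hwlen using fun C : PrimeClass Γ => hS C.rep
  have hB0 : 0 < B := zero_lt_one.trans_le hB
  -- The product of the word is conjugate to the representative, so the word determines the class;
  -- sums over classes are dominated by sums over words.
  have hw_inj : Function.Injective w := fun C C' h => by
    have h1 : δ C * C.rep * (δ C)⁻¹ = δ C' * C'.rep * (δ C')⁻¹ := by rw [← hw, ← hw, h]
    have h2 : IsConj C.rep C'.rep :=
      (isConj_iff.2 ⟨δ C, rfl⟩).trans (h1 ▸ (isConj_iff.2 ⟨δ C', rfl⟩).symm)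
    have h3 := ConjClasses.mk_eq_mk_iff_isConj.2 h2
    refine Subtype.ext ?_
    rwa [show ConjClasses.mk C.rep = C.1 from Quotient.out_eq C.1,
      show ConjClasses.mk C'.rep = C'.1 from Quotient.out_eq C'.1] at h3
  -- With `c = log A + 1` one gets `(|S| + 1) q = e^{-1}`. The extra `1` keeps `A ≥ 1`, hence `c >
  -- 0`, even for empty `S`.
  set A : ℝ := B * (S.card + 1) with hA
  have hA1 : 1 ≤ A := by
    have : (0 : ℝ) ≤ S.card := Nat.cast_nonneg _
    nlinarith
  set c : ℝ := Real.log A + 1 with hc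
  have hcpos : 0 < c := by have := Real.log_nonneg hA1; linarith
  set q : ℝ := B * Real.exp (-c) with hq
  have hq0 : 0 ≤ q := by positivity
  have hqS : (S.card + 1) * q < 1 := by
    have : (S.card + 1) * q = Real.exp (-1) := by
      rw [hq, hc, neg_add, Real.exp_add, Real.exp_neg (Real.log A), Real.exp_log (by linarith), hA]
      field_simp
    rw [this]
    exact Real.exp_lt_one_iff.2 (by norm_num)
  have hq1 : q ≤ 1 := by nlinarith [Nat.cast_nonneg (α := ℝ) S.card]
  set x : ℝ := Real.exp (-l₀) with hx
  set d : ℝ := Module.finrank ℂ V * Module.finrank ℂ W with hd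
  set P := Module.finrank ℂ (TensorProduct ℝ ℂ (nbar n)) with hP
  set β : ℕ → ℝ := fun k => ((k : ℝ) + 1) ^ P * x ^ k with hβ
  have hβ0 : ∀ k, 0 ≤ β k := fun k => by positivity
  have hβs : Summable β := by
    have h1 := summable_pow_mul_geometric_of_norm_lt_one P (r := x)
      (by rw [Real.norm_of_nonneg (Real.exp_pos _).le]; exact Real.exp_lt_one_iff.2 (by linarith))
    have h2 := ((summable_nat_add_iff 1).2 h1).mul_left x⁻¹
    refine h2.congr fun k => ?_
    have hx0 : x ≠ 0 := (Real.exp_pos _).ne'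
    simp only [hβ, pow_succ x]
    push_cast
    field_simp
  have hαs : Summable fun C => q ^ (w C).length :=
    (summable_pow_length S hq0 (by
      rw [Fintype.card_coe]; nlinarith)).comp_injective hw_inj
  set L : ℝ := d * (K * Real.exp (2 * c)) with hL
  have hL0 : 0 ≤ L := by positivity
  -- A uniform bound for the exponents `u`, which turns `e^u - 1` into the linear bound `u e^T`.
  set T : ℝ := L * ∑' k, β k with hT
  refine ⟨c, hcpos, fun D hD hDc => ?_⟩
  refine uniform_double_product (fun (p : PrimeClass Γ × ℕ) s => 𝒢.selbergFactor χ σ p.1.rep p.2 s)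
    (a := fun p => L * Real.exp T * (q ^ (w p.1).length * β p.2))
    ((hαs.mul_of_nonneg hβs (fun C => by positivity) hβ0).mul_left _) hD
    (fun p => (LorentzModel.continuous_selbergFactor χ σ p.1.rep p.2).continuousOn) ?_
  rintro ⟨C, k⟩ s hs
  have hl := hlen C.rep (LorentzModel.rep_ne_one C)
  have hχ : GrowthLE (χ C.rep) (K * B ^ (w C).length) :=
    GrowthLE.of_conj χ (δ := δ C) (by rw [← hw]; exact hword (w C))
  have hop := hgeo.growthLE_twistedOp hσ (by positivity) hχ k
  have hE := LorentzModel.norm_exp_le (n := n) (hl₀.le.trans hl) (hDc hs).le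
  refine (LorentzModel.norm_selbergFactor_sub_one_le (by positivity) hop hE).trans ?_
  -- The constant `e^{2c}` absorbs the `+ 2` in the bound for the word length.
  have hbase : Real.exp (-(c * 𝒢.length C.rep)) ≤
      Real.exp (2 * c) * Real.exp (-c) ^ (w C).length := by
    rw [← Real.exp_nat_mul, ← Real.exp_add, Real.exp_le_exp]
    nlinarith [hwlen C]
  have hlx : Real.exp (-(𝒢.length C.rep)) ≤ x := Real.exp_le_exp.2 (neg_le_neg hl)
  have hu : d * ((k : ℝ) + 1) ^ P * (Real.exp (-(c * 𝒢.length C.rep)) *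
      (K * B ^ (w C).length * Real.exp (-(𝒢.length C.rep)) ^ k)) ≤
      L * (q ^ (w C).length * β k) := by
    calc _ ≤ d * ((k : ℝ) + 1) ^ P * (Real.exp (2 * c) * Real.exp (-c) ^ (w C).length *
          (K * B ^ (w C).length * x ^ k)) := by
          gcongr
      _ = _ := by rw [hL, hq, hβ, mul_pow]; ring
  have hu2 : L * (q ^ (w C).length * β k) ≤ T := by
    rw [hT]
    refine mul_le_mul_of_nonneg_left ?_ hL0
    refine le_trans ?_ (hβs.le_tsum k fun j _ => hβ0 j)
    exact mul_le_of_le_one_left (hβ0 k) (pow_le_one₀ hq0 hq1)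
  have hnn : 0 ≤ L * (q ^ (w C).length * β k) :=
    mul_nonneg hL0 (mul_nonneg (by positivity) (hβ0 k))
  calc _ ≤ Real.exp (L * (q ^ (w C).length * β k)) - 1 := by gcongr
    _ ≤ L * (q ^ (w C).length * β k) * Real.exp (L * (q ^ (w C).length * β k)) :=
      exp_sub_one_le_mul_exp _
    _ ≤ L * (q ^ (w C).length * β k) * Real.exp T := by gcongr
    _ = _ := by ring
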